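/- Let $k$ be a field. A standard graded $k$-algebra is a nonzero commutative graded $k$-algebra $R=\bigoplus_{j\ge 0}R_j$ with $R_0=k$, $\dim_k R_1<\infty$, that is generated by $R_1$ as a $k$-algebra; write $R_{\ge 1}=\bigoplus_{j\ge1}R_j$ and view $k=R/R_{\ge 1}$ as a graded $R$-module. $R$ is Koszul if $k$ has a linear free resolution over $R$, i.e. a graded free resolution whose $i$-th term is generated in degree $i$ for every $i\ge 0$. For a finitely generated graded $R$-module $M$ with components in degrees $\ge 0$ put $$P^R_M(s,z)=\sum_{i,j\ge 0}\dim_k \operatorname{Tor}^R_i(k,M)_j\, s^j z^i .$$ A surjective morphism $\varphi\colon Q\to R$ of standard graded $k$-algebras with $\ker\varphi\subseteq (Q_{\ge 1})^2$ is Golod if $$P^R_k(s,z)=\frac{P^Q_k(s,z)}{1-z\,(P^Q_R(s,z)-1)} .$$ A standard graded $k$-algebra is a complete intersection if it is the quotient of a standard graded polynomial ring $k[x_1,\dots,x_n]$ by an ideal generated by a regular sequence of homogeneous elements. $R$ has the Backelin-Roos property if there is a surjective Golod morphism $Q\to R$ with $Q$ a standard graded complete intersection $k$-algebra. The codimension of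 $R$ is $c=\dim_k R_1-\dim R$, where $\dim R$ is the Krull dimension, and the $h$-polynomial of $R$ is $h_R(z)=(1-z)^{\dim R}\sum_{j\ge 0}(\dim_k R_j)\,z^j\in\mathbb{Z}[z]$. Let $R$ be a standard graded Koszul $k$-algebra that has the Backelin-Roos property, with codimension $c$ and $h$-polynomial $h_R(z)$. Then the formal power series $$1-\frac{h_R(-z)}{(1-z)^c}$$ has non-negative coefficients. -/

import Mathlib

open scoped PowerSeries

universe u v w

noncomputable section

/-- A graded algebra `A = ⨁ A_j` over the field `k` is *standard graded* if `A_0 = k`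
(with `A ≠ 0`), `A_1` is finite-dimensional, and `A` is generated by `A_1` as a `k`-algebra. -/
structure IsStandardGraded {k : Type u} [Field k] {A : Type v} [CommRing A] [Algebra k A]
    (𝒜 : ℕ → Submodule k A) [GradedAlgebra 𝒜] : Prop where
  nontrivial : Nontrivial A
  degree_zero : 𝒜 0 = 1
  finite_one : FiniteDimensional k (𝒜 1)
  adjoin_one : Algebra.adjoin k (𝒜 1 : Set A) = ⊤

/-- The ideal `A_{≥ 1}`, which is the homogeneous maximal ideal when `A` is standard graded. -/
abbrev irrelevantIdeal {k : Type u} [Field k] {A : Type v} [CommRing A] [Algebra k A]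
    (𝒜 : ℕ → Submodule k A) [GradedAlgebra 𝒜] : Ideal A :=
  (HomogeneousIdeal.irrelevant 𝒜).toIdeal

/-- The residue field `A / A_{≥ 1}` (which is `k` for standard graded `A`), as an `A`-module. -/
abbrev ResidueModule {k : Type u} [Field k] {A : Type v} [CommRing A] [Algebra k A]
    (𝒜 : ℕ → Submodule k A) [GradedAlgebra 𝒜] : Type v :=
  A ⧸ irrelevantIdeal 𝒜

/-- The grading on `A / A_{≥ 1}` induced from that of `A`; it is concentrated in degree `0`. -/
def residueGrading {k : Type u} [Field k] {A : Type v} [CommRing A] [Algebra k A]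
    (𝒜 : ℕ → Submodule k A) [GradedAlgebra 𝒜] (j : ℕ) : Submodule k (ResidueModule 𝒜) :=
  (𝒜 j).map (Ideal.Quotient.mkₐ k (irrelevantIdeal 𝒜)).toLinearMap

/-- The degree `j` component of the graded free module `⨁_b A(-deg b)`. -/
def freeDegreePart {k : Type u} [Field k] {A : Type v} [CommRing A] [Algebra k A]
    (𝒜 : ℕ → Submodule k A) {n : ℕ} (deg : Fin n → ℕ) (j : ℕ) :
    Submodule k (Fin n → A) :=
  Submodule.pi Set.univ fun b => if deg b ≤ j then 𝒜 (j - deg b) else ⊥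

/-- A graded free resolution
`⋯ → F_1 → F_0 → M → 0`, with `F_i = ⨁_{b < rank i} A(-deg i b)` of finite rank and all maps
homogeneous of degree `0`, of the `A`-module `M` with homogeneous components `ℳ j`. -/
structure GradedFreeResolution {k : Type u} [Field k] {A : Type v} [CommRing A] [Algebra k A]
    (𝒜 : ℕ → Submodule k A) {M : Type w} [AddCommGroup M] [Module k M] [Module A M]
    (ℳ : ℕ → Submodule k M) where
  rank : ℕ → ℕ
  deg : ∀ i, Fin (rank i) → ℕ
  d : ∀ i, (Fin (rank (i + 1)) → A) →ₗ[A] (Fin (rank i) → A)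
  ε : (Fin (rank 0) → A) →ₗ[A] M
  d_homogeneous : ∀ i b, d i (Pi.single b 1) ∈ freeDegreePart 𝒜 (deg i) (deg (i + 1) b)
  ε_homogeneous : ∀ b, ε (Pi.single b 1) ∈ ℳ (deg 0 b)
  ε_surjective : Function.Surjective ε
  exact_zero : Function.Exact (d 0) ε
  exact_succ : ∀ i, Function.Exact (d (i + 1)) (d i)

namespace GradedFreeResolution

variable {k : Type u} [Field k] {A : Type v} [CommRing A] [Algebra k A]
  {𝒜 : ℕ → Submodule k A} [GradedAlgebra 𝒜]
  {M : Type w} [AddCommGroup M] [Module k M] [Module A M] {ℳ : ℕ → Submodule k M}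

/-- `𝔪 F_i` with `𝔪 = A_{≥ 1}`, so that `k ⊗_A F_i = F_i / 𝔪 F_i`. -/
def maxSub (F : GradedFreeResolution 𝒜 ℳ) (i : ℕ) : Submodule k (Fin (F.rank i) → A) :=
  (irrelevantIdeal 𝒜 • (⊤ : Submodule A (Fin (F.rank i) → A))).restrictScalars k

/-- Elements of `(F_i)_j` that map to cycles of degree `j` in `k ⊗_A F_i`. -/
def torCycles (F : GradedFreeResolution 𝒜 ℳ) :
    (i : ℕ) → (j : ℕ) → Submodule k (Fin (F.rank i) → A)
  | 0, j => freeDegreePart 𝒜 (F.deg 0) j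
  | i + 1, j => freeDegreePart 𝒜 (F.deg (i + 1)) j ⊓
      (F.maxSub i).comap ((F.d i).restrictScalars k)

/-- Elements of `F_i` that map to boundaries in `k ⊗_A F_i`. -/
def torBoundaries (F : GradedFreeResolution 𝒜 ℳ) (i : ℕ) :
    Submodule k (Fin (F.rank i) → A) :=
  F.maxSub i ⊔ LinearMap.range ((F.d i).restrictScalars k)

/-- `Tor_i^A(k, M)_j`, computed as the degree `j` part of the homology `H_i(k ⊗_A F)`. -/
abbrev Tor (F : GradedFreeResolution 𝒜 ℳ) (i j : ℕ) : Type v :=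
  F.torCycles i j ⧸ (F.torBoundaries i).submoduleOf (F.torCycles i j)

end GradedFreeResolution

open Classical in
/-- The graded Betti number `β_{i,j}^A(M) = dim_k Tor_i^A(k, M)_j`. Here `Tor` is computed from
some graded free resolution by modules of finite rank; one exists for every finitely generated
graded module with components in non-negative degrees over a standard graded algebra. -/
def gradedBetti {k : Type u} [Field k] {A : Type v} [CommRing A] [Algebra k A]
    (𝒜 : ℕ → Submodule k A) [GradedAlgebra 𝒜]
    {M : Type w} [AddCommGroup M] [Module k M] [Module A M] (ℳ : ℕ → Submodule k M)
    (i j : ℕ) : ℕ :=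
  if h : Nonempty (GradedFreeResolution 𝒜 ℳ) then Module.finrank k (h.some.Tor i j) else 0

/-- The graded Poincaré series `P^A_M(s, z) = ∑ β_{i,j}^A(M) s^j z^i`, in `ℤ⟦s⟧⟦z⟧`. -/
def poincareSeries {k : Type u} [Field k] {A : Type v} [CommRing A] [Algebra k A]
    (𝒜 : ℕ → Submodule k A) [GradedAlgebra 𝒜]
    {M : Type w} [AddCommGroup M] [Module k M] [Module A M] (ℳ : ℕ → Submodule k M) :
    ℤ⟦X⟧⟦X⟧ :=
  PowerSeries.mk fun i => PowerSeries.mk fun j => (gradedBetti 𝒜 ℳ i j : ℤ)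

/-- `A` is *Koszul* if the `A`-module `k` has a linear free resolution: one in which `F_i` is
generated in degree `i` for all `i`. -/
def IsKoszul {k : Type u} [Field k] {A : Type v} [CommRing A] [Algebra k A]
    (𝒜 : ℕ → Submodule k A) [GradedAlgebra 𝒜] : Prop :=
  ∃ F : GradedFreeResolution 𝒜 (residueGrading 𝒜), ∀ i b, F.deg i b = i

/-- A morphism `φ : Q → R` of standard graded algebras is a *surjective Golod morphism* if it is
surjective, its kernel lies in `(Q_{≥ 1})²`, and
`P^R_k(s, z) = P^Q_k(s, z) / (1 - z (P^Q_R(s, z) - 1))`.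
The denominator has constant term `1` as a series in `z`, hence is invertible. -/
def IsGolod {k : Type u} [Field k] {Q : Type v} [CommRing Q] [Algebra k Q]
    {R : Type w} [CommRing R] [Algebra k R]
    {𝒬 : ℕ → Submodule k Q} [GradedAlgebra 𝒬] {ℛ : ℕ → Submodule k R} [GradedAlgebra ℛ]
    (φ : 𝒬 →ₐᵍ[k] ℛ) : Prop :=
  letI : Module Q R := Module.compHom R (φ : Q →ₐ[k] R).toRingHom
  Function.Surjective φ ∧
  RingHom.ker (φ : Q →ₐ[k] R).toRingHom ≤ irrelevantIdeal 𝒬 ^ 2 ∧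
  poincareSeries ℛ (residueGrading ℛ) * (1 - PowerSeries.X * (poincareSeries 𝒬 ℛ - 1)) =
    poincareSeries 𝒬 (residueGrading 𝒬)

/-- A standard graded algebra is a *complete intersection* if it is the quotient of a standard
graded polynomial ring by an ideal generated by a regular sequence of homogeneous elements. -/
def IsGradedCompleteIntersection {k : Type u} [Field k] {Q : Type v} [CommRing Q] [Algebra k Q]
    (𝒬 : ℕ → Submodule k Q) : Prop :=
  ∃ (n : ℕ) (π : MvPolynomial (Fin n) k →ₐ[k] Q) (fs : List (MvPolynomial (Fin n) k)),
    (∀ i, π (MvPolynomial.X i) ∈ 𝒬 1) ∧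
    Function.Surjective π ∧
    (∀ f ∈ fs, ∃ e, f.IsHomogeneous e) ∧
    RingTheory.Sequence.IsRegular (MvPolynomial (Fin n) k) fs ∧
    RingHom.ker π = Ideal.ofList fs

/-- `R` has the *Backelin-Roos property* if there is a surjective Golod morphism `Q → R` with `Q`
a standard graded complete intersection. (Such a `Q` is a quotient of a polynomial ring over `k`
in finitely many variables, so taking it in the universe of `k` is no restriction.) -/
def HasBackelinRoos {k : Type u} [Field k] {R : Type v} [CommRing R] [Algebra k R]
    (ℛ : ℕ → Submodule k R) [GradedAlgebra ℛ] : Prop :=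
  ∃ (Q : Type u) (_ : CommRing Q) (_ : Algebra k Q) (𝒬 : ℕ → Submodule k Q)
    (_ : GradedAlgebra 𝒬) (φ : 𝒬 →ₐᵍ[k] ℛ),
    IsStandardGraded 𝒬 ∧ IsGradedCompleteIntersection 𝒬 ∧ IsGolod φ

/-- The Krull dimension as a natural number (it is finite for standard graded algebras). -/
def krullDimNat (R : Type v) [CommRing R] : ℕ := ((ringKrullDim R).unbotD 0).toNat

/-- The codimension `embdim R - dim R`, where `embdim R = dim_k R_1 ≥ dim R`. -/
def gradedCodim {k : Type u} [Field k] {R : Type v} [CommRing R] [Algebra k R]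
    (ℛ : ℕ → Submodule k R) : ℕ :=
  Module.finrank k (ℛ 1) - krullDimNat R

/-- The Hilbert series `H_R(z) = ∑_j dim_k(R_j) z^j`. -/
def hilbertSeries {k : Type u} [Field k] {R : Type v} [CommRing R] [Algebra k R]
    (ℛ : ℕ → Submodule k R) : ℤ⟦X⟧ :=
  PowerSeries.mk fun j => (Module.finrank k (ℛ j) : ℤ)

/-- The `h`-polynomial `h_R(z) = (1 - z)^{dim R} H_R(z)` of a standard graded algebra `R`,
regarded as an element of `ℤ⟦z⟧ ⊇ ℤ[z]`. -/
def hPolynomial {k : Type u} [Field k] {R : Type v} [CommRing R] [Algebra k R]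
    (ℛ : ℕ → Submodule k R) : ℤ⟦X⟧ :=
  (1 - PowerSeries.X) ^ krullDimNat R * hilbertSeries ℛ

end

/-! Let `Q → R` be Golod with `Q` a complete intersection, and set `T = z (P^Q_R - 1)`, so that
`P^R_k = P^R_k T + P^Q_k`. Koszulness of `R` says that `P^R_k` is a series in the product `sz`. All
three series have non-negative coefficients and `P^R_k` has positive constant term, so nothing can
cancel off the diagonal and both `T` and `P^Q_k` are diagonal too (`isDiagonal_of_mul_one_sub`).
Hence `Q` is Koszul. With `N ≥ 0` the diagonal of `T`, the identity `P(-z) H(z) = 1` for linear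
resolutions gives `(1 - N(z)) H_Q(-z) = H_R(-z)`. The coefficient of `z^2` in `N` is the minimal
number `μ` of generators of `ker(Q → R)`.

A Koszul complete intersection is cut out by quadrics. Its defining ideal in `e = dim Q_1` variables
is generated in degree two (`ker_aeval_relation_eq_span`), and the Hilbert series shows that there
are as many quadrics as relations of degree two in the given regular sequence, say `m`. Krull's
height theorem gives `dim Q ≥ e - m`, while the regular sequence gives `dim Q ≤ e - #{i | d_i ≠ 1}`;
so no relation has degree above two and `H_Q = (1 - z^2)^m / (1 - z)^e`
(`koszul_completeIntersection`).

Put `c = g + m`. Since `1 - z^2 = (1 - z)(1 + z)`, the series `A = h_R(-z) / (1 - z)^c` satisfies `A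
(1 - z^2)^g = 1 - N` (`hilbert_quotient_identity`). The ideal defining `R` has `m + μ` generators,
so Krull's theorem gives `g ≤ μ`. Each division of `1 - N` by `1 - z^2` replaces `N` by `(N - z^2) /
(1 - z^2)`, which uses up one unit of the coefficient of `z^2`; that coefficient is large enough to
do this `g` times (`nonneg_of_mul_one_sub_sq_pow`).

Because Betti numbers are defined through an arbitrary resolution, a comparison theorem and the
existence of minimal resolutions are proved along the way. -/

noncomputable section

/-! ### Homogeneous components in graded free modules -/

section FreeComponent

variable {k : Type u} [Field k] {A : Type v} [CommRing A] [Algebra k A]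
  (𝒜 : ℕ → Submodule k A)

theorem mem_freeDegreePart {n : ℕ} {deg : Fin n → ℕ} {j : ℕ} {v : Fin n → A} :
    v ∈ freeDegreePart 𝒜 deg j ↔
      ∀ b, v b ∈ (if deg b ≤ j then 𝒜 (j - deg b) else ⊥ : Submodule k A) := by
  simp [freeDegreePart, Submodule.mem_pi]

theorem single_mem_freeDegreePart {n : ℕ} (deg : Fin n → ℕ) (b : Fin n) {j : ℕ} {a : A}
    (h : a ∈ 𝒜 j) : Pi.single b a ∈ freeDegreePart 𝒜 deg (deg b + j) := by
  rw [mem_freeDegreePart]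
  intro c
  rcases eq_or_ne c b with rfl | hc
  · simpa using h
  · simp [hc]

variable [GradedAlgebra 𝒜]

/-- The projection of `⨁_b A(-deg b)` onto its component of degree `j`. -/
def freeComponent {n : ℕ} (deg : Fin n → ℕ) (j : ℕ) : (Fin n → A) →ₗ[k] (Fin n → A) :=
  LinearMap.pi fun b =>
    if deg b ≤ j then GradedAlgebra.proj 𝒜 (j - deg b) ∘ₗ LinearMap.proj b else 0

variable {𝒜}

theorem freeComponent_apply {n : ℕ} (deg : Fin n → ℕ) (j : ℕ) (v : Fin n → A) (b : Fin n) :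
    freeComponent 𝒜 deg j v b =
      if deg b ≤ j then GradedAlgebra.proj 𝒜 (j - deg b) (v b) else 0 := by
  simp only [freeComponent, LinearMap.pi_apply]
  split_ifs <;> simp

theorem proj_mem (j : ℕ) (a : A) : GradedAlgebra.proj 𝒜 j a ∈ 𝒜 j := by
  rw [GradedAlgebra.proj_apply]; exact SetLike.coe_mem _

theorem proj_of_mem {j : ℕ} {a : A} (h : a ∈ 𝒜 j) : GradedAlgebra.proj 𝒜 j a = a := by
  rw [GradedAlgebra.proj_apply, DirectSum.decompose_of_mem_same _ h]

theorem proj_of_mem_ne {i j : ℕ} {a : A} (h : a ∈ 𝒜 i) (hij : i ≠ j) :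
    GradedAlgebra.proj 𝒜 j a = 0 := by
  rw [GradedAlgebra.proj_apply, DirectSum.decompose_of_mem_ne _ h hij]

theorem proj_mul_of_mem {t j : ℕ} (a : A) {b : A} (h : b ∈ 𝒜 t) :
    GradedAlgebra.proj 𝒜 j (a * b) =
      if t ≤ j then GradedAlgebra.proj 𝒜 (j - t) a * b else 0 := by
  simp only [GradedAlgebra.proj_apply]
  exact DirectSum.coe_decompose_mul_of_right_mem 𝒜 j h

theorem freeComponent_mem {n : ℕ} (deg : Fin n → ℕ) (j : ℕ) (v : Fin n → A) :
    freeComponent 𝒜 deg j v ∈ freeDegreePart 𝒜 deg j := by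
  rw [mem_freeDegreePart]
  intro b
  rw [freeComponent_apply]
  split_ifs
  · exact proj_mem _ _
  · simp

theorem freeComponent_of_mem {n : ℕ} {deg : Fin n → ℕ} {j : ℕ} {v : Fin n → A}
    (h : v ∈ freeDegreePart 𝒜 deg j) : freeComponent 𝒜 deg j v = v := by
  rw [mem_freeDegreePart] at h
  ext b
  have hb := h b
  rw [freeComponent_apply]
  split_ifs at hb ⊢
  · exact proj_of_mem hb
  · simpa using hb.symm

theorem freeComponent_of_mem_ne {n : ℕ} {deg : Fin n → ℕ} {i j : ℕ} {v : Fin n → A}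
    (h : v ∈ freeDegreePart 𝒜 deg i) (hij : i ≠ j) : freeComponent 𝒜 deg j v = 0 := by
  rw [mem_freeDegreePart] at h
  ext b
  have hb := h b
  rw [freeComponent_apply]
  split_ifs at hb ⊢
  · exact proj_of_mem_ne hb (by omega)
  · rw [(Submodule.mem_bot k).1 hb, map_zero]; rfl
  · rfl
  · rfl

theorem freeComponent_smul {n : ℕ} {deg : Fin n → ℕ} {t : ℕ} (j : ℕ) (a : A) {w : Fin n → A}
    (h : w ∈ freeDegreePart 𝒜 deg t) :
    freeComponent 𝒜 deg j (a • w) =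
      if t ≤ j then GradedAlgebra.proj 𝒜 (j - t) a • w else 0 := by
  rw [mem_freeDegreePart] at h
  ext b
  have hb := h b
  rw [freeComponent_apply, Pi.smul_apply, smul_eq_mul]
  by_cases h1 : deg b ≤ t
  · rw [if_pos h1] at hb
    rw [proj_mul_of_mem a hb]
    split_ifs with h2 h3 h4 h5
    · rw [Pi.smul_apply, smul_eq_mul]; congr 2; congr 1; omega
    · omega
    · omega
    · rfl
    · omega
    · rfl
  · rw [if_neg h1, Submodule.mem_bot] at hb
    split_ifs <;> simp [hb]

theorem single_one_mem_freeDegreePart {n : ℕ} (deg : Fin n → ℕ) (b : Fin n) :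
    (Pi.single b 1 : Fin n → A) ∈ freeDegreePart 𝒜 deg (deg b) :=
  single_mem_freeDegreePart 𝒜 deg b (j := 0) SetLike.GradedOne.one_mem

theorem linearMap_eq_sum {n : ℕ} {N : Type*} [AddCommGroup N] [Module A N]
    (f : (Fin n → A) →ₗ[A] N) (v : Fin n → A) : f v = ∑ b, v b • f (Pi.single b 1) := by
  conv_lhs => rw [← LinearMap.sum_single_apply (fun _ => A) v]
  rw [map_sum]
  refine Finset.sum_congr rfl fun b _ => ?_
  rw [← map_smul]
  congr 1
  rw [← Pi.single_smul, smul_eq_mul, mul_one]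

/-- This is what allows preimages and syzygies to be replaced by their homogeneous components. -/
theorem freeComponent_map {m n : ℕ} {deg : Fin m → ℕ} {deg' : Fin n → ℕ}
    (f : (Fin m → A) →ₗ[A] (Fin n → A))
    (hf : ∀ b, f (Pi.single b 1) ∈ freeDegreePart 𝒜 deg' (deg b)) (j : ℕ) (v : Fin m → A) :
    f (freeComponent 𝒜 deg j v) = freeComponent 𝒜 deg' j (f v) := by
  rw [linearMap_eq_sum, linearMap_eq_sum f v, map_sum]
  refine Finset.sum_congr rfl fun b _ => ?_
  rw [freeComponent_smul j _ (hf b), freeComponent_apply]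
  split_ifs <;> simp

theorem map_mem_freeDegreePart {m n : ℕ} {deg : Fin m → ℕ} {deg' : Fin n → ℕ}
    (f : (Fin m → A) →ₗ[A] (Fin n → A))
    (hf : ∀ b, f (Pi.single b 1) ∈ freeDegreePart 𝒜 deg' (deg b)) {j : ℕ} {v : Fin m → A}
    (hv : v ∈ freeDegreePart 𝒜 deg j) : f v ∈ freeDegreePart 𝒜 deg' j := by
  rw [← freeComponent_of_mem hv, freeComponent_map f hf]
  exact freeComponent_mem _ _ _

theorem freeDegreePart_induction {n : ℕ} (deg : Fin n → ℕ) {p : (Fin n → A) → Prop}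
    (zero : p 0) (homog : ∀ j v, v ∈ freeDegreePart 𝒜 deg j → p v)
    (add : ∀ v w, p v → p w → p (v + w)) (v : Fin n → A) : p v := by
  have hsum : ∀ (s : Finset (Fin n)) (f : Fin n → Fin n → A), (∀ b, p (f b)) →
      p (∑ b ∈ s, f b) := by
    intro s f hf
    induction s using Finset.cons_induction with
    | empty => simpa using zero
    | cons b s hb ih => rw [Finset.sum_cons]; exact add _ _ (hf b) ih
  rw [← LinearMap.sum_single_apply (fun _ => A) v]
  refine hsum _ _ fun b => ?_
  induction v b using DirectSum.Decomposition.inductionOn 𝒜 with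
  | zero => simpa using zero
  | homogeneous a => exact homog _ _ (single_mem_freeDegreePart 𝒜 deg b a.2)
  | add x y hx hy => rw [Pi.single_add]; exact add _ _ hx hy

theorem exists_sum_freeComponent {n : ℕ} (deg : Fin n → ℕ) (v : Fin n → A) :
    ∃ N, ∀ N', N ≤ N' → ∑ j ∈ Finset.range N', freeComponent 𝒜 deg j v = v := by
  induction v using freeDegreePart_induction (𝒜 := 𝒜) deg with
  | zero => exact ⟨0, by simp⟩
  | homog j v hv =>
    refine ⟨j + 1, fun N' hN' => ?_⟩
    rw [Finset.sum_eq_single j]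
    · exact freeComponent_of_mem hv
    · intro i _ hij; exact freeComponent_of_mem_ne hv hij.symm
    · intro h; simp at h; omega
  | add v w hv hw =>
    obtain ⟨N₁, h₁⟩ := hv
    obtain ⟨N₂, h₂⟩ := hw
    refine ⟨max N₁ N₂, fun N' hN' => ?_⟩
    simp only [map_add, Finset.sum_add_distrib]
    rw [h₁ _ (le_trans (le_max_left _ _) hN'), h₂ _ (le_trans (le_max_right _ _) hN')]

theorem mem_of_freeComponent_mem {n : ℕ} (deg : Fin n → ℕ) (Z : Submodule A (Fin n → A))
    {v : Fin n → A} (h : ∀ j, freeComponent 𝒜 deg j v ∈ Z) : v ∈ Z := by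
  obtain ⟨N, hN⟩ := exists_sum_freeComponent (𝒜 := 𝒜) deg v
  rw [← hN N le_rfl]
  exact Submodule.sum_mem _ fun j _ => h j

end FreeComponent

/-! ### Cyclic graded modules -/

section GradedQuotient

variable {k : Type u} [Field k] {A : Type v} [CommRing A] [Algebra k A]
  (𝒜 : ℕ → Submodule k A) [GradedAlgebra 𝒜]
  {M : Type w} [AddCommGroup M] [Module k M] [Module A M] (ℳ : ℕ → Submodule k M)

/-- The surjection `π : A → M` identifies the graded module `M` with the quotient of `A` by a
homogeneous ideal. -/
structure IsGradedQuotient (π : A →ₗ[A] M) : Prop where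
  surjective : Function.Surjective π
  proj_mem_ker : ∀ a j, π a = 0 → π (GradedAlgebra.proj 𝒜 j a) = 0
  mem_iff : ∀ j m, m ∈ ℳ j ↔ ∃ a ∈ 𝒜 j, π a = m

variable {𝒜 ℳ} {π : A →ₗ[A] M}

/-- The family `ℳ` is not assumed to be a direct sum decomposition, so components are taken in `A`
after lifting along `π`; homogeneity of `ker π` makes the result independent of the lift. -/
theorem IsGradedQuotient.map_freeComponent (h : IsGradedQuotient 𝒜 ℳ π) {n : ℕ}
    {deg : Fin n → ℕ} (ε : (Fin n → A) →ₗ[A] M) (hε : ∀ b, ε (Pi.single b 1) ∈ ℳ (deg b))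
    {j : ℕ} {v : Fin n → A} (hv : ε v ∈ ℳ j) : ε (freeComponent 𝒜 deg j v) = ε v := by
  choose c hc hc' using fun b => (h.mem_iff _ _).1 (hε b)
  have key : ∀ v, ε v = π (∑ b, v b * c b) := by
    intro v
    rw [linearMap_eq_sum ε v, map_sum π]
    refine Finset.sum_congr rfl fun b _ => ?_
    rw [← hc', ← smul_eq_mul, map_smul]
  have key2 : ε (freeComponent 𝒜 deg j v) =
      π (GradedAlgebra.proj 𝒜 j (∑ b, v b * c b)) := by
    rw [key, map_sum (GradedAlgebra.proj 𝒜 j)]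
    congr 1
    refine Finset.sum_congr rfl fun b _ => ?_
    rw [proj_mul_of_mem _ (hc b), freeComponent_apply]
    split_ifs <;> simp
  obtain ⟨a, ha, ha'⟩ := (h.mem_iff _ _).1 hv
  -- Two lifts of `ε v`, one of them homogeneous of degree `j`, differ by an element of `ker π`,
  -- hence so do their components of degree `j`.
  have h0 := h.proj_mem_ker (∑ b, v b * c b - a) j (by rw [map_sub, ← key, ha', sub_self])
  rw [map_sub, map_sub, proj_of_mem ha, sub_eq_zero] at h0
  rw [key2, h0, ha']

end GradedQuotient

theorem map_mem_smul_top {A : Type*} [CommRing A] {V W : Type*} [AddCommGroup V] [Module A V]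
    [AddCommGroup W] [Module A W] (I : Ideal A) (f : V →ₗ[A] W) {v : V}
    (hv : v ∈ I • (⊤ : Submodule A V)) : f v ∈ I • (⊤ : Submodule A W) := by
  have h1 := Submodule.mem_map_of_mem (f := f) hv
  rw [Submodule.map_smul''] at h1
  exact Submodule.smul_mono le_rfl le_top h1

/-! ### Comparison of resolutions and independence of Betti numbers -/

namespace GradedFreeResolution

section Comparison

variable {k : Type u} [Field k] {A : Type v} [CommRing A] [Algebra k A]
  {𝒜 : ℕ → Submodule k A} [GradedAlgebra 𝒜]
  {M : Type w} [AddCommGroup M] [Module k M] [Module A M] {ℳ : ℕ → Submodule k M}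
  {π : A →ₗ[A] M}

/-- An arbitrary preimage of a homogeneous element can be cut down to its component of the right
degree, since `G.d i` commutes with taking components. -/
theorem exists_lift (G : GradedFreeResolution 𝒜 ℳ) (i : ℕ) {n : ℕ} (deg : Fin n → ℕ)
    (g : (Fin n → A) →ₗ[A] (Fin (G.rank i) → A))
    (hg : ∀ b, g (Pi.single b 1) ∈ freeDegreePart 𝒜 (G.deg i) (deg b))
    (hr : ∀ v, g v ∈ LinearMap.range (G.d i)) :
    ∃ f : (Fin n → A) →ₗ[A] (Fin (G.rank (i + 1)) → A),
      (∀ b, f (Pi.single b 1) ∈ freeDegreePart 𝒜 (G.deg (i + 1)) (deg b)) ∧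
      ∀ v, G.d i (f v) = g v := by
  have h1 : ∀ b, ∃ x ∈ freeDegreePart 𝒜 (G.deg (i + 1)) (deg b),
      G.d i x = g (Pi.single b 1) := by
    intro b
    obtain ⟨x, hx⟩ := hr (Pi.single b 1)
    refine ⟨freeComponent 𝒜 (G.deg (i + 1)) (deg b) x, freeComponent_mem _ _ _, ?_⟩
    rw [freeComponent_map _ (G.d_homogeneous i), hx, freeComponent_of_mem (hg b)]
  choose x hx hx' using h1
  refine ⟨Fintype.linearCombination A x, fun b => ?_, fun v => ?_⟩
  · simpa [Fintype.linearCombination_apply_single] using hx b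
  · rw [linearMap_eq_sum g v, Fintype.linearCombination_apply, map_sum]
    simp [hx']

theorem exists_lift_zero (hπ : IsGradedQuotient 𝒜 ℳ π) (G : GradedFreeResolution 𝒜 ℳ)
    {n : ℕ} (deg : Fin n → ℕ) (g : (Fin n → A) →ₗ[A] M)
    (hg : ∀ b, g (Pi.single b 1) ∈ ℳ (deg b)) :
    ∃ f : (Fin n → A) →ₗ[A] (Fin (G.rank 0) → A),
      (∀ b, f (Pi.single b 1) ∈ freeDegreePart 𝒜 (G.deg 0) (deg b)) ∧
      ∀ v, G.ε (f v) = g v := by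
  have h1 : ∀ b, ∃ x ∈ freeDegreePart 𝒜 (G.deg 0) (deg b), G.ε x = g (Pi.single b 1) := by
    intro b
    obtain ⟨x, hx⟩ := G.ε_surjective (g (Pi.single b 1))
    refine ⟨freeComponent 𝒜 (G.deg 0) (deg b) x, freeComponent_mem _ _ _, ?_⟩
    rw [hπ.map_freeComponent _ G.ε_homogeneous (by rw [hx]; exact hg b), hx]
  choose x hx hx' using h1
  refine ⟨Fintype.linearCombination A x, fun b => ?_, fun v => ?_⟩
  · simpa [Fintype.linearCombination_apply_single] using hx b
  · rw [linearMap_eq_sum g v, Fintype.linearCombination_apply, map_sum]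
    simp [hx']

/-- The kernel of the map out of `F_i` in the augmented resolution. -/
def cycles (F : GradedFreeResolution 𝒜 ℳ) : (i : ℕ) → Submodule A (Fin (F.rank i) → A)
  | 0 => LinearMap.ker F.ε
  | i + 1 => LinearMap.ker (F.d i)

omit [GradedAlgebra 𝒜] in
theorem range_d (F : GradedFreeResolution 𝒜 ℳ) (i : ℕ) : LinearMap.range (F.d i) = F.cycles i := by
  cases i with
  | zero => exact (LinearMap.exact_iff.1 F.exact_zero).symm
  | succ i => exact (LinearMap.exact_iff.1 (F.exact_succ i)).symm

omit [GradedAlgebra 𝒜] in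
theorem d_mem_cycles (F : GradedFreeResolution 𝒜 ℳ) (i : ℕ) (v : Fin (F.rank (i + 1)) → A) :
    F.d i v ∈ F.cycles i := by
  rw [← range_d]; exact ⟨v, rfl⟩

/-- A homogeneous map from `F_i` to `G_i` that sends cycles to cycles. -/
structure PreservesCycles (F G : GradedFreeResolution 𝒜 ℳ) (i : ℕ)
    (f : (Fin (F.rank i) → A) →ₗ[A] (Fin (G.rank i) → A)) : Prop where
  homogeneous : ∀ b, f (Pi.single b 1) ∈ freeDegreePart 𝒜 (G.deg i) (F.deg i b)
  mem_cycles : ∀ v ∈ F.cycles i, f v ∈ G.cycles i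

/-- The invariant concerns `f` in the single index `i`, so a chain map can be built by plain
recursion on `i`. -/
theorem PreservesCycles.exists_next {F G : GradedFreeResolution 𝒜 ℳ} {i : ℕ}
    {f : (Fin (F.rank i) → A) →ₗ[A] (Fin (G.rank i) → A)} (hf : PreservesCycles F G i f) :
    ∃ f' : (Fin (F.rank (i + 1)) → A) →ₗ[A] (Fin (G.rank (i + 1)) → A),
      PreservesCycles F G (i + 1) f' ∧ ∀ v, G.d i (f' v) = f (F.d i v) := by
  obtain ⟨f', h1, h2⟩ := G.exists_lift i (F.deg (i + 1)) (f ∘ₗ F.d i)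
    (fun b => map_mem_freeDegreePart f hf.homogeneous (F.d_homogeneous i b))
    (fun v => by rw [range_d]; exact hf.mem_cycles _ (F.d_mem_cycles i v))
  refine ⟨f', ⟨h1, fun v hv => ?_⟩, h2⟩
  change G.d i (f' v) = 0
  have hv' : F.d i v = 0 := hv
  rw [h2, LinearMap.comp_apply, hv', map_zero]

/-- A homogeneous map of complexes between two resolutions that is compatible with the
augmentations. -/
structure Comparison (F G : GradedFreeResolution 𝒜 ℳ) where
  f : ∀ i, (Fin (F.rank i) → A) →ₗ[A] (Fin (G.rank i) → A)
  homogeneous : ∀ i b, f i (Pi.single b 1) ∈ freeDegreePart 𝒜 (G.deg i) (F.deg i b)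
  ε_comp : ∀ v, G.ε (f 0 v) = F.ε v
  d_comp : ∀ i v, G.d i (f (i + 1) v) = f i (F.d i v)

theorem nonempty_comparison (hπ : IsGradedQuotient 𝒜 ℳ π) (F G : GradedFreeResolution 𝒜 ℳ) :
    Nonempty (Comparison F G) := by
  obtain ⟨f₀, h1, h2⟩ := G.exists_lift_zero hπ (F.deg 0) F.ε F.ε_homogeneous
  have h0 : PreservesCycles F G 0 f₀ := by
    refine ⟨h1, fun v hv => ?_⟩
    change G.ε (f₀ v) = 0
    rw [h2]; exact hv
  let f : ∀ i, {f : (Fin (F.rank i) → A) →ₗ[A] (Fin (G.rank i) → A) // PreservesCycles F G i f} :=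
    fun i => Nat.rec ⟨f₀, h0⟩
      (fun i f => ⟨f.2.exists_next.choose, f.2.exists_next.choose_spec.1⟩) i
  exact ⟨⟨fun i => (f i).1, fun i => (f i).2.homogeneous, h2,
    fun i => (f i).2.exists_next.choose_spec.2⟩⟩

/-- The composition of two comparison maps. -/
def Comparison.comp {F G H : GradedFreeResolution 𝒜 ℳ} (g : Comparison G H)
    (f : Comparison F G) : Comparison F H where
  f i := g.f i ∘ₗ f.f i
  homogeneous i b := map_mem_freeDegreePart (g.f i) (g.homogeneous i) (f.homogeneous i b)
  ε_comp v := by simp [g.ε_comp, f.ε_comp]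
  d_comp i v := by simp [g.d_comp, f.d_comp]

/-- Partial data of a homotopy between a self-comparison and the identity. -/
structure HomotopyStep (F : GradedFreeResolution 𝒜 ℳ) (h : Comparison F F) (i : ℕ)
    (s : (Fin (F.rank i) → A) →ₗ[A] (Fin (F.rank (i + 1)) → A)) : Prop where
  homogeneous : ∀ b, s (Pi.single b 1) ∈ freeDegreePart 𝒜 (F.deg (i + 1)) (F.deg i b)
  d_comp : ∀ v, F.d i (s (F.d i v)) = h.f i (F.d i v) - F.d i v

/-- On boundaries the term of the homotopy formula with index `i - 1` vanishes. Demanding the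
formula there only makes the invariant uniform in `i` and suffices for the next lift. -/
theorem HomotopyStep.exists_next {F : GradedFreeResolution 𝒜 ℳ} {h : Comparison F F} {i : ℕ}
    {s : (Fin (F.rank i) → A) →ₗ[A] (Fin (F.rank (i + 1)) → A)} (hs : HomotopyStep F h i s) :
    ∃ s', HomotopyStep F h (i + 1) s' ∧
      ∀ v, F.d (i + 1) (s' v) = h.f (i + 1) v - v - s (F.d i v) := by
  obtain ⟨s', h1, h2⟩ := F.exists_lift (i + 1) (F.deg (i + 1))
    (h.f (i + 1) - LinearMap.id - s ∘ₗ F.d i)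
    (fun b => Submodule.sub_mem _ (Submodule.sub_mem _ (h.homogeneous _ b)
      (single_one_mem_freeDegreePart _ b))
      (map_mem_freeDegreePart s hs.homogeneous (F.d_homogeneous i b)))
    (fun v => by
      rw [range_d]
      change F.d i _ = 0
      simp [hs.d_comp, h.d_comp])
  have hd : ∀ w, F.d i (F.d (i + 1) w) = 0 := fun w => F.d_mem_cycles (i + 1) w
  refine ⟨s', ⟨h1, fun v => ?_⟩, fun v => by rw [h2]; rfl⟩
  rw [h2]
  simp [hd]

theorem Comparison.exists_homotopy {F : GradedFreeResolution 𝒜 ℳ} (h : Comparison F F) :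
    ∃ s : ∀ i, (Fin (F.rank i) → A) →ₗ[A] (Fin (F.rank (i + 1)) → A),
      (∀ v, F.d 0 (s 0 v) = h.f 0 v - v) ∧
      ∀ i v, F.d (i + 1) (s (i + 1) v) = h.f (i + 1) v - v - s i (F.d i v) := by
  obtain ⟨s₀, h1, h2⟩ := F.exists_lift 0 (F.deg 0) (h.f 0 - LinearMap.id)
    (fun b => Submodule.sub_mem _ (h.homogeneous _ b) (single_one_mem_freeDegreePart _ b))
    (fun v => by
      rw [range_d]
      change F.ε _ = 0
      simp [h.ε_comp])
  let s : ∀ i, {s // HomotopyStep F h i s} :=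
    fun i => Nat.rec ⟨s₀, ⟨h1, fun v => by rw [h2]; rfl⟩⟩
      (fun i s => ⟨s.2.exists_next.choose, s.2.exists_next.choose_spec.1⟩) i
  exact ⟨fun i => (s i).1, h2, fun i => (s i).2.exists_next.choose_spec.2⟩

theorem map_maxSub {F G : GradedFreeResolution 𝒜 ℳ} {i j : ℕ}
    (f : (Fin (F.rank i) → A) →ₗ[A] (Fin (G.rank j) → A)) {v : Fin (F.rank i) → A}
    (hv : v ∈ F.maxSub i) : f v ∈ G.maxSub j :=
  map_mem_smul_top (irrelevantIdeal 𝒜) f hv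

theorem Comparison.map_torCycles {F G : GradedFreeResolution 𝒜 ℳ} (f : Comparison F G)
    {i j : ℕ} {v : Fin (F.rank i) → A} (hv : v ∈ F.torCycles i j) :
    f.f i v ∈ G.torCycles i j := by
  cases i with
  | zero => exact map_mem_freeDegreePart _ (f.homogeneous 0) hv
  | succ i =>
    refine ⟨map_mem_freeDegreePart _ (f.homogeneous (i + 1)) hv.1, ?_⟩
    change G.d i (f.f (i + 1) v) ∈ G.maxSub i
    rw [f.d_comp]
    exact map_maxSub _ hv.2

theorem Comparison.map_torBoundaries {F G : GradedFreeResolution 𝒜 ℳ} (f : Comparison F G)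
    {i : ℕ} {v : Fin (F.rank i) → A} (hv : v ∈ F.torBoundaries i) :
    f.f i v ∈ G.torBoundaries i := by
  obtain ⟨x, hx, y, ⟨z, rfl⟩, rfl⟩ := Submodule.mem_sup.1 hv
  rw [map_add]
  refine Submodule.add_mem_sup (map_maxSub _ hx) ⟨f.f (i + 1) z, f.d_comp i z⟩

/-- The map on `Tor` induced by a comparison map. -/
def Comparison.torMap {F G : GradedFreeResolution 𝒜 ℳ} (f : Comparison F G) (i j : ℕ) :
    F.Tor i j →ₗ[k] G.Tor i j :=
  Submodule.mapQ _ _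
    (((f.f i).restrictScalars k).restrict fun _ hv => f.map_torCycles hv)
    (fun _ hv => f.map_torBoundaries hv)

/-- The composite is homotopic to the identity. For a cycle `v` of `k ⊗ F`, the summand `s (d v)` of
the homotopy lies in `𝔪 F` and the other one is a boundary. -/
theorem Comparison.torMap_comp_self {F G : GradedFreeResolution 𝒜 ℳ} (f : Comparison F G) (g : Comparison G F) (i j : ℕ)
    (x : F.Tor i j) : g.torMap i j (f.torMap i j x) = x := by
  obtain ⟨⟨v, hv⟩, rfl⟩ := Submodule.Quotient.mk_surjective _ x
  obtain ⟨s, h0, h1⟩ := (g.comp f).exists_homotopy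
  refine (Submodule.Quotient.eq _).2 ?_
  change g.f i (f.f i v) - v ∈ F.torBoundaries i
  cases i with
  | zero => exact Submodule.mem_sup_right ⟨s 0 v, h0 v⟩
  | succ i =>
    have h2 : g.f (i + 1) (f.f (i + 1) v) - v = s i (F.d i v) + F.d (i + 1) (s (i + 1) v) := by
      rw [h1]; simp [Comparison.comp]
    rw [h2]
    exact Submodule.add_mem_sup (map_maxSub _ hv.2) ⟨_, rfl⟩

theorem finrank_tor_eq (hπ : IsGradedQuotient 𝒜 ℳ π) (F G : GradedFreeResolution 𝒜 ℳ)
    (i j : ℕ) : Module.finrank k (F.Tor i j) = Module.finrank k (G.Tor i j) := by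
  obtain ⟨f⟩ := nonempty_comparison hπ F G
  obtain ⟨g⟩ := nonempty_comparison hπ G F
  exact (LinearEquiv.ofLinearMap (f.torMap i j) (g.torMap i j)
    (LinearMap.ext fun x => g.torMap_comp_self f i j x)
    (LinearMap.ext fun x => f.torMap_comp_self g i j x)).finrank_eq

theorem gradedBetti_eq_finrank (hπ : IsGradedQuotient 𝒜 ℳ π) (F : GradedFreeResolution 𝒜 ℳ)
    (i j : ℕ) : gradedBetti 𝒜 ℳ i j = Module.finrank k (F.Tor i j) := by
  have h : Nonempty (GradedFreeResolution 𝒜 ℳ) := ⟨F⟩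
  rw [gradedBetti, dif_pos h]
  exact finrank_tor_eq hπ _ _ i j

end Comparison

end GradedFreeResolution

/-! ### The irrelevant ideal -/

section Irrelevant

variable {k : Type u} [Field k] {A : Type v} [CommRing A] [Algebra k A]
  {𝒜 : ℕ → Submodule k A} [GradedAlgebra 𝒜]

theorem mem_irrelevantIdeal {a : A} : a ∈ irrelevantIdeal 𝒜 ↔ GradedAlgebra.proj 𝒜 0 a = 0 :=
  HomogeneousIdeal.mem_irrelevant_iff 𝒜 a

theorem mem_irrelevantIdeal_of_mem {j : ℕ} (hj : j ≠ 0) {a : A} (h : a ∈ 𝒜 j) :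
    a ∈ irrelevantIdeal 𝒜 :=
  mem_irrelevantIdeal.2 (proj_of_mem_ne h hj)

theorem eq_zero_of_mem_irrelevantIdeal {a : A} (h0 : a ∈ 𝒜 0) (h : a ∈ irrelevantIdeal 𝒜) :
    a = 0 := by
  rw [← proj_of_mem h0]; exact mem_irrelevantIdeal.1 h

theorem mem_smul_top_iff {n : ℕ} (I : Ideal A) {v : Fin n → A} :
    v ∈ I • (⊤ : Submodule A (Fin n → A)) ↔ ∀ b, v b ∈ I := by
  constructor
  · intro h b
    have h1 := map_mem_smul_top I (LinearMap.proj (R := A) (φ := fun _ : Fin n => A) b) h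
    rwa [smul_eq_mul, Ideal.mul_top] at h1
  · intro h
    have h1 := linearMap_eq_sum (LinearMap.id : (Fin n → A) →ₗ[A] (Fin n → A)) v
    rw [LinearMap.id_apply] at h1
    rw [h1]
    exact Submodule.sum_mem _ fun b _ => Submodule.smul_mem_smul (h b) trivial

omit [GradedAlgebra 𝒜] in
theorem exists_algebraMap_of_mem_zero (h0 : 𝒜 0 = 1) {a : A} (h : a ∈ 𝒜 0) : ∃ c : k, algebraMap k A c = a := by
  rw [h0] at h; exact Submodule.mem_one.1 h

end Irrelevant

/-! ### Minimal resolutions and their Betti numbers -/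

namespace GradedFreeResolution

variable {k : Type u} [Field k] {A : Type v} [CommRing A] [Algebra k A]
  {𝒜 : ℕ → Submodule k A} [GradedAlgebra 𝒜]
  {M : Type w} [AddCommGroup M] [Module k M] [Module A M] {ℳ : ℕ → Submodule k M}

theorem mem_maxSub {F : GradedFreeResolution 𝒜 ℳ} {i : ℕ} {v : Fin (F.rank i) → A} :
    v ∈ F.maxSub i ↔ ∀ b, v b ∈ irrelevantIdeal 𝒜 :=
  mem_smul_top_iff _

/-- A resolution is minimal if all its differentials vanish modulo `A_{≥ 1}`. -/
def IsMinimal (F : GradedFreeResolution 𝒜 ℳ) : Prop :=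
  ∀ i v, F.d i v ∈ F.maxSub i

/-- The matrix entries of the differentials have degree `(i + 1) - i = 1`. -/
theorem isMinimal_of_linear {F : GradedFreeResolution 𝒜 ℳ} (hF : ∀ i b, F.deg i b = i) :
    F.IsMinimal := by
  intro i v
  rw [linearMap_eq_sum]
  refine Submodule.sum_mem _ fun b _ => ?_
  refine Submodule.smul_mem (irrelevantIdeal 𝒜 • (⊤ : Submodule A _)) _ (mem_maxSub.2 fun c => ?_)
  have h := (mem_freeDegreePart 𝒜).1 (F.d_homogeneous i b) c
  rw [hF, hF, if_pos (by omega)] at h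
  exact mem_irrelevantIdeal_of_mem (by omega) h

theorem IsMinimal.torCycles_eq {F : GradedFreeResolution 𝒜 ℳ} (hF : F.IsMinimal) (i j : ℕ) :
    F.torCycles i j = freeDegreePart 𝒜 (F.deg i) j := by
  cases i with
  | zero => rfl
  | succ i => exact inf_eq_left.2 fun v _ => hF i v

theorem IsMinimal.torBoundaries_eq {F : GradedFreeResolution 𝒜 ℳ} (hF : F.IsMinimal) (i : ℕ) :
    F.torBoundaries i = F.maxSub i := by
  refine sup_eq_left.2 ?_
  rintro _ ⟨v, rfl⟩
  exact hF i v

/-- For a minimal resolution the differentials of `k ⊗ F` vanish, so `Tor` is `F / 𝔪 F`, with the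
classes of the free generators as a basis. -/
theorem IsMinimal.finrank_tor [Nontrivial A] (h0 : 𝒜 0 = 1) {F : GradedFreeResolution 𝒜 ℳ}
    (hF : F.IsMinimal) (i j : ℕ) :
    Module.finrank k (F.Tor i j) = Fintype.card {b // F.deg i b = j} := by
  let Φ : ({b // F.deg i b = j} → k) →ₗ[k] (Fin (F.rank i) → A) :=
    LinearMap.pi fun b => if h : F.deg i b = j then
      Algebra.linearMap k A ∘ₗ LinearMap.proj ⟨b, h⟩ else 0
  have hΦ : ∀ c b, Φ c b = if h : F.deg i b = j then algebraMap k A (c ⟨b, h⟩) else 0 := by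
    intro c b
    simp only [Φ, LinearMap.pi_apply]
    split_ifs <;> rfl
  have hmem : ∀ c, Φ c ∈ F.torCycles i j := by
    intro c
    rw [hF.torCycles_eq, mem_freeDegreePart]
    intro b
    rw [hΦ]
    by_cases h : F.deg i b = j
    · rw [dif_pos h, if_pos h.le, h, Nat.sub_self]; exact SetLike.algebraMap_mem_graded 𝒜 _
    · rw [dif_neg h]; exact zero_mem _
  let Ψ := Submodule.mkQ ((F.torBoundaries i).submoduleOf (F.torCycles i j)) ∘ₗ
    Φ.codRestrict (F.torCycles i j) hmem
  have hinj : Function.Injective Ψ := by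
    rw [← LinearMap.ker_eq_bot, LinearMap.ker_eq_bot']
    intro c hc
    have h1 : Φ c ∈ F.torBoundaries i := by
      have h2 : (⟨Φ c, hmem c⟩ : F.torCycles i j) ∈
          (F.torBoundaries i).submoduleOf (F.torCycles i j) := by
        rw [← Submodule.Quotient.mk_eq_zero]; exact hc
      exact h2
    rw [hF.torBoundaries_eq, mem_maxSub] at h1
    ext ⟨b, hb⟩
    have h2 := h1 b
    rw [hΦ, dif_pos hb] at h2
    have h3 := eq_zero_of_mem_irrelevantIdeal (SetLike.algebraMap_mem_graded 𝒜 _) h2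
    simpa using h3
  have hsurj : Function.Surjective Ψ := by
    intro x
    obtain ⟨⟨v, hv⟩, rfl⟩ := Submodule.Quotient.mk_surjective _ x
    have hv' := hv
    rw [hF.torCycles_eq, mem_freeDegreePart] at hv'
    have h1 : ∀ b : {b // F.deg i b = j}, ∃ c : k, algebraMap k A c = v b := by
      intro b
      refine exists_algebraMap_of_mem_zero h0 ?_
      have := hv' b
      rwa [b.2, if_pos le_rfl, Nat.sub_self] at this
    choose c hc using h1
    refine ⟨c, (Submodule.Quotient.eq _).2 ?_⟩
    change Φ c - v ∈ F.torBoundaries i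
    rw [hF.torBoundaries_eq, mem_maxSub]
    intro b
    rw [Pi.sub_apply, hΦ]
    split_ifs with h
    · rw [hc, sub_self]; exact zero_mem _
    · rw [zero_sub, neg_mem_iff]
      have := hv' b
      split_ifs at this with h2
      · exact mem_irrelevantIdeal_of_mem (by omega) this
      · rw [(Submodule.mem_bot k).1 this]; exact zero_mem _
  rw [← (LinearEquiv.ofBijective Ψ ⟨hinj, hsurj⟩).finrank_eq, Module.finrank_fintype_fun_eq_card]

end GradedFreeResolution

/-! ### Existence of minimal resolutions -/

section MinimalResolution

variable {k : Type u} [Field k] {A : Type v} [CommRing A] [Algebra k A]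
  {𝒜 : ℕ → Submodule k A} [GradedAlgebra 𝒜]

theorem exists_homogeneous_generators [IsNoetherianRing A] {n : ℕ} (deg : Fin n → ℕ)
    (Z : Submodule A (Fin n → A)) (hZ : ∀ v ∈ Z, ∀ j, freeComponent 𝒜 deg j v ∈ Z) :
    ∃ (r : ℕ) (deg' : Fin r → ℕ) (x : Fin r → Fin n → A),
      (∀ b, x b ∈ freeDegreePart 𝒜 deg (deg' b)) ∧ Submodule.span A (Set.range x) = Z := by
  set H : Set (Fin n → A) := {v | v ∈ Z ∧ ∃ j, v ∈ freeDegreePart 𝒜 deg j} with hH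
  have h1 : Submodule.span A H = Z := by
    refine le_antisymm (Submodule.span_le.2 fun v hv => hv.1) fun v hv => ?_
    refine mem_of_freeComponent_mem (𝒜 := 𝒜) deg _ fun j => Submodule.subset_span ?_
    exact ⟨hZ v hv j, j, freeComponent_mem _ _ _⟩
  have h2 : (Submodule.span A H).FG := IsNoetherian.noetherian _
  obtain ⟨s, hs, hs'⟩ := (Submodule.fg_span_iff_fg_span_finset_subset _).1 h2
  choose deg' hdeg' using fun b : s => (hs b.2).2
  refine ⟨s.card, fun b => deg' (s.equivFin.symm b), fun b => s.equivFin.symm b,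
    fun b => hdeg' _, ?_⟩
  have h3 : Set.range (fun b => (s.equivFin.symm b : Fin n → A)) = s := by
    ext v
    constructor
    · rintro ⟨b, rfl⟩; exact (s.equivFin.symm b).2
    · intro hv; exact ⟨s.equivFin ⟨v, hv⟩, by simp⟩
  rw [h3, ← hs', h1]

/-- Graded Nakayama: in a homogeneous generating set of least size, a relation with a coefficient
outside `A_{≥ 1}` would make one generator redundant. -/
theorem exists_minimal_generators [IsNoetherianRing A] (h0 : 𝒜 0 = 1) {n : ℕ}
    (deg : Fin n → ℕ) (Z : Submodule A (Fin n → A))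
    (hZ : ∀ v ∈ Z, ∀ j, freeComponent 𝒜 deg j v ∈ Z) :
    ∃ (r : ℕ) (deg' : Fin r → ℕ) (x : Fin r → Fin n → A),
      (∀ b, x b ∈ freeDegreePart 𝒜 deg (deg' b)) ∧ Submodule.span A (Set.range x) = Z ∧
      ∀ a : Fin r → A, ∑ b, a b • x b = 0 → ∀ b, a b ∈ irrelevantIdeal 𝒜 := by
  classical
  have hex := exists_homogeneous_generators deg Z hZ
  obtain ⟨deg', x, hx, hspan⟩ := Nat.find_spec hex
  have hmin : ∀ m < Nat.find hex, ¬ _ := fun m hm => Nat.find_min hex hm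
  generalize Nat.find hex = r at deg' x hx hspan hmin
  refine ⟨r, deg', x, hx, hspan, fun a ha b₀ => ?_⟩
  by_contra hb₀
  cases r with
  | zero => exact b₀.elim0
  | succ r =>
    refine hmin r (Nat.lt_succ_self r) ⟨deg' ∘ b₀.succAbove, x ∘ b₀.succAbove,
      fun b => hx _, ?_⟩
    rw [← hspan]
    refine le_antisymm (Submodule.span_mono (Set.range_comp_subset_range _ _)) ?_
    -- In this component of the relation, `x b₀` is multiplied by the degree zero part of `a b₀`, a
    -- nonzero scalar, so it can be solved for.
    have h1 := congrArg (freeComponent 𝒜 deg (deg' b₀)) ha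
    simp only [map_sum, map_zero, freeComponent_smul _ _ (hx _)] at h1
    rw [Fin.sum_univ_succAbove _ b₀, if_pos le_rfl, Nat.sub_self] at h1
    obtain ⟨c, hc⟩ := exists_algebraMap_of_mem_zero h0 (proj_mem (𝒜 := 𝒜) 0 (a b₀))
    have hc0 : c ≠ 0 := by
      rintro rfl
      exact hb₀ (mem_irrelevantIdeal.2 (by rw [← hc, map_zero]))
    set W := Submodule.span A (Set.range (x ∘ b₀.succAbove)) with hW
    have h2 : algebraMap k A c • x b₀ ∈ W := by
      rw [hc, eq_neg_of_add_eq_zero_left h1]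
      refine neg_mem (Submodule.sum_mem _ fun b _ => ?_)
      split_ifs
      · exact Submodule.smul_mem _ _ (Submodule.subset_span ⟨b, rfl⟩)
      · exact zero_mem _
    have h3 : x b₀ ∈ W := by
      have := Submodule.smul_mem W (algebraMap k A c⁻¹) h2
      rwa [smul_smul, ← map_mul, inv_mul_cancel₀ hc0, map_one, one_smul] at this
    refine Submodule.span_le.2 ?_
    rintro _ ⟨b, rfl⟩
    rcases eq_or_ne b b₀ with rfl | hb
    · exact h3
    · obtain ⟨b', rfl⟩ := Fin.exists_succAbove_eq hb
      exact Submodule.subset_span ⟨b', rfl⟩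

variable (𝒜) in
/-- A graded submodule of a graded free module of finite rank. -/
structure GradedSubmoduleOfFree where
  n : ℕ
  deg : Fin n → ℕ
  Z : Submodule A (Fin n → A)
  freeComponent_mem : ∀ v ∈ Z, ∀ j, freeComponent 𝒜 deg j v ∈ Z

namespace GradedSubmoduleOfFree

variable [IsNoetherianRing A] (h0 : 𝒜 0 = 1) (s : GradedSubmoduleOfFree 𝒜)

/-- The minimal number of homogeneous generators. -/
def numGens : ℕ := (exists_minimal_generators h0 s.deg s.Z s.freeComponent_mem).choose

/-- Degrees of minimal generators. -/
def genDeg : Fin (s.numGens h0) → ℕ :=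
  (exists_minimal_generators h0 s.deg s.Z s.freeComponent_mem).choose_spec.choose

/-- Minimal homogeneous generators. -/
def gen : Fin (s.numGens h0) → Fin s.n → A :=
  (exists_minimal_generators h0 s.deg s.Z s.freeComponent_mem).choose_spec.choose_spec.choose

theorem gen_spec : (∀ b, s.gen h0 b ∈ freeDegreePart 𝒜 s.deg (s.genDeg h0 b)) ∧
    Submodule.span A (Set.range (s.gen h0)) = s.Z ∧
      ∀ a : Fin (s.numGens h0) → A, ∑ b, a b • s.gen h0 b = 0 → ∀ b, a b ∈ irrelevantIdeal 𝒜 :=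
  (exists_minimal_generators h0 s.deg s.Z s.freeComponent_mem).choose_spec.choose_spec.choose_spec

/-- The minimal free cover. -/
def cover : (Fin (s.numGens h0) → A) →ₗ[A] (Fin s.n → A) :=
  Fintype.linearCombination A (s.gen h0)

theorem cover_single (b) : s.cover h0 (Pi.single b 1) = s.gen h0 b := by
  simp [cover, Fintype.linearCombination_apply_single]

theorem range_cover : LinearMap.range (s.cover h0) = s.Z := by
  rw [cover, Fintype.range_linearCombination, (s.gen_spec h0).2.1]

/-- The first syzygy module of a graded submodule of a free module. -/
def syzygy : GradedSubmoduleOfFree 𝒜 where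
  n := s.numGens h0
  deg := s.genDeg h0
  Z := LinearMap.ker (s.cover h0)
  freeComponent_mem v hv j := by
    rw [LinearMap.mem_ker] at hv ⊢
    rw [freeComponent_map (s.cover h0) (deg' := s.deg)
      (fun b => by rw [cover_single]; exact (s.gen_spec h0).1 b), hv, map_zero]

theorem cover_homogeneous (b) :
    s.cover h0 (Pi.single b 1) ∈ freeDegreePart 𝒜 s.deg (s.genDeg h0 b) := by
  rw [cover_single]; exact (s.gen_spec h0).1 b

theorem exact_cover : Function.Exact ((s.syzygy h0).cover h0) (s.cover h0) :=
  LinearMap.exact_iff.2 ((s.syzygy h0).range_cover h0).symm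

theorem cover_mem (v) : s.cover h0 v ∈ s.Z := by
  rw [← range_cover h0]; exact ⟨v, rfl⟩

theorem mem_irrelevantIdeal_of_mem_syzygy {y : Fin (s.numGens h0) → A}
    (hy : y ∈ (s.syzygy h0).Z) (b) : y b ∈ irrelevantIdeal 𝒜 := by
  refine (s.gen_spec h0).2.2 y ?_ b
  rw [← Fintype.linearCombination_apply A]
  exact hy

/-- The iterated syzygy modules. -/
def iterSyzygy : ℕ → GradedSubmoduleOfFree 𝒜
  | 0 => s
  | i + 1 => (iterSyzygy i).syzygy h0

end GradedSubmoduleOfFree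

namespace GradedFreeResolution

variable {M : Type w} [AddCommGroup M] [Module k M] [Module A M] {ℳ : ℕ → Submodule k M}
  {π : A →ₗ[A] M}

/-- `F` starts with the free module `A`, and its augmentation is given by `π`. -/
structure IsCyclicAt (F : GradedFreeResolution 𝒜 ℳ) (π : A →ₗ[A] M) (b₀ : Fin (F.rank 0)) :
    Prop where
  eq : ∀ b, b = b₀
  deg_eq : F.deg 0 b₀ = 0
  ε_eq : ∀ v, F.ε v = π (v b₀)

theorem exists_minimal [IsNoetherianRing A] (h0 : 𝒜 0 = 1) (hπ : IsGradedQuotient 𝒜 ℳ π)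
    (hker : ∀ a, π a = 0 → a ∈ irrelevantIdeal 𝒜) :
    ∃ (F : GradedFreeResolution 𝒜 ℳ) (b₀ : Fin (F.rank 0)), F.IsMinimal ∧ F.IsCyclicAt π b₀ := by
  let ε : (Fin 1 → A) →ₗ[A] M := π ∘ₗ LinearMap.proj 0
  let s : GradedSubmoduleOfFree 𝒜 :=
    { n := 1
      deg := fun _ => 0
      Z := LinearMap.ker ε
      freeComponent_mem := fun v hv j => by
        change π (freeComponent 𝒜 (fun _ => 0) j v 0) = 0
        rw [freeComponent_apply, if_pos (Nat.zero_le _)]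
        exact hπ.proj_mem_ker _ _ hv }
  -- `t i` is the `(i + 1)`-st syzygy of `M`, inside the free module `F_i`; thus `F_0 = A`, and
  -- `F_{i+1}` is the minimal cover of `t i`.
  let t := s.iterSyzygy h0
  have hε : ∀ b : Fin 1, ε (Pi.single b 1) ∈ ℳ 0 := by
    intro b
    refine (hπ.mem_iff _ _).2 ⟨1, SetLike.GradedOne.one_mem, ?_⟩
    rw [Subsingleton.elim b 0]
    simp [ε]
  have hex : Function.Exact (s.cover h0) ε := LinearMap.exact_iff.2 (s.range_cover h0).symm
  refine ⟨⟨fun i => (t i).n, fun i => (t i).deg, fun i => (t i).cover h0, ε,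
    fun i => (t i).cover_homogeneous h0, hε, ?_, hex,
    fun i => (t i).exact_cover h0⟩, (0 : Fin 1), ?_,
    ⟨fun b => Subsingleton.elim (α := Fin 1) _ _, rfl, fun _ => rfl⟩⟩
  · intro m
    obtain ⟨a, rfl⟩ := hπ.surjective m
    exact ⟨fun _ => a, rfl⟩
  -- The image of `F_1` lies in `ker π`, which is in `A_{≥ 1}` by `hker`; later images are syzygies
  -- of minimal generators.
  · rintro (_ | i) v
    · refine mem_maxSub.2 fun b => ?_
      have h1 : π (s.cover h0 v 0) = 0 := s.cover_mem h0 v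
      have hb : b = (0 : Fin 1) := Subsingleton.elim (α := Fin 1) _ _
      rw [hb]
      exact hker _ h1
    · exact mem_maxSub.2 fun b =>
        (t i).mem_irrelevantIdeal_of_mem_syzygy h0 (((t i).syzygy h0).cover_mem h0 v) b

end GradedFreeResolution

end MinimalResolution

/-! ### The residue field as a graded module -/

section Residue

variable {k : Type u} [Field k] {A : Type v} [CommRing A] [Algebra k A]
  {𝒜 : ℕ → Submodule k A} [GradedAlgebra 𝒜]

theorem isGradedQuotient_residue :
    IsGradedQuotient 𝒜 (residueGrading 𝒜) (irrelevantIdeal 𝒜).mkQ where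
  surjective := Submodule.mkQ_surjective _
  proj_mem_ker a j ha := by
    rw [Submodule.mkQ_apply, Submodule.Quotient.mk_eq_zero] at ha ⊢
    rcases eq_or_ne j 0 with rfl | hj
    · rw [mem_irrelevantIdeal.1 ha]; exact zero_mem _
    · exact mem_irrelevantIdeal_of_mem hj (proj_mem j a)
  mem_iff j m := Iff.rfl

theorem mkQ_irrelevantIdeal_eq_zero (a : A) (h : (irrelevantIdeal 𝒜).mkQ a = 0) :
    a ∈ irrelevantIdeal 𝒜 := by
  rwa [Submodule.mkQ_apply, Submodule.Quotient.mk_eq_zero] at h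

theorem finrank_residueGrading [Nontrivial A] (h0 : 𝒜 0 = 1) (j : ℕ) :
    Module.finrank k (residueGrading 𝒜 j) = if j = 0 then 1 else 0 := by
  split_ifs with hj
  · subst hj
    rw [residueGrading, h0, Submodule.one_eq_span, Submodule.map_span, Set.image_singleton]
    refine finrank_span_singleton ?_
    intro h
    have h1 : (1 : A) ∈ irrelevantIdeal 𝒜 := Ideal.Quotient.eq_zero_iff_mem.1 h
    exact one_ne_zero (eq_zero_of_mem_irrelevantIdeal SetLike.GradedOne.one_mem h1)
  · have : residueGrading 𝒜 j = ⊥ := by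
      rw [eq_bot_iff]
      rintro _ ⟨a, ha, rfl⟩
      exact Ideal.Quotient.eq_zero_iff_mem.2 (mem_irrelevantIdeal_of_mem hj ha)
    rw [this, finrank_bot]

end Residue

/-! ### Hilbert series from linear resolutions -/

section LinearResolution

variable {k : Type u} [Field k] {A : Type v} [CommRing A] [Algebra k A]
  {𝒜 : ℕ → Submodule k A}

theorem freeDegreePart_of_le {n i t : ℕ} {deg : Fin n → ℕ} (hdeg : ∀ b, deg b = i) (hi : i ≤ t) :
    freeDegreePart 𝒜 deg t = LinearMap.range ((𝒜 (t - i)).subtype.compLeft (Fin n)) := by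
  rw [LinearMap.range_compLeft]
  simp [freeDegreePart, hdeg, hi]

theorem freeDegreePart_of_lt {n i t : ℕ} {deg : Fin n → ℕ} (hdeg : ∀ b, deg b = i) (hi : t < i) :
    freeDegreePart 𝒜 deg t = ⊥ := by
  rw [eq_bot_iff]
  intro v hv
  ext b
  have := (mem_freeDegreePart 𝒜).1 hv b
  rwa [hdeg, if_neg (by omega)] at this

theorem finrank_freeDegreePart [∀ j, FiniteDimensional k (𝒜 j)] {n i t : ℕ} {deg : Fin n → ℕ}
    (hdeg : ∀ b, deg b = i) :
    Module.finrank k (freeDegreePart 𝒜 deg t) =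
      if i ≤ t then n * Module.finrank k (𝒜 (t - i)) else 0 := by
  split_ifs with hi
  · rw [freeDegreePart_of_le hdeg hi, LinearMap.finrank_range_of_inj, Module.finrank_pi_fintype]
    · simp
    · intro x y hxy
      ext b
      exact congrFun hxy b
  · rw [freeDegreePart_of_lt hdeg (by omega), finrank_bot]

theorem finiteDimensional_freeDegreePart [∀ j, FiniteDimensional k (𝒜 j)] {n i t : ℕ}
    {deg : Fin n → ℕ} (hdeg : ∀ b, deg b = i) : FiniteDimensional k (freeDegreePart 𝒜 deg t) := by
  by_cases hi : i ≤ t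
  · rw [freeDegreePart_of_le hdeg hi]; infer_instance
  · rw [freeDegreePart_of_lt hdeg (by omega)]; infer_instance

theorem finrank_map_add_finrank_inf_ker {V W : Type*} [AddCommGroup V] [Module k V]
    [AddCommGroup W] [Module k W] (f : V →ₗ[k] W) (U : Submodule k V) [FiniteDimensional k U] :
    Module.finrank k (U.map f) + Module.finrank k (LinearMap.ker f ⊓ U : Submodule k V) =
      Module.finrank k U := by
  rw [← LinearMap.finrank_range_add_finrank_ker (f.domRestrict U), LinearMap.range_domRestrict,
    LinearMap.ker_domRestrict, ← Submodule.submoduleOf]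
  congr 1
  have : (LinearMap.ker f ⊓ U).submoduleOf U = (LinearMap.ker f).submoduleOf U := by
    simp [Submodule.submoduleOf]
  rw [← this]
  exact (Submodule.submoduleOfEquivOfLe inf_le_right).finrank_eq.symm

namespace GradedFreeResolution

variable [GradedAlgebra 𝒜] {F : GradedFreeResolution 𝒜 (residueGrading 𝒜)}

/-- The dimension of the degree `t` part of the `i`-th cycles. -/
def cycleDim (F : GradedFreeResolution 𝒜 (residueGrading 𝒜)) (t i : ℕ) : ℕ :=
  Module.finrank k ((F.cycles i).restrictScalars k ⊓ freeDegreePart 𝒜 (F.deg i) t :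
    Submodule k (Fin (F.rank i) → A))

theorem finrank_add_cycleDim_zero [∀ j, FiniteDimensional k (𝒜 j)]
    (hF : ∀ i b, F.deg i b = i) (t : ℕ) :
    Module.finrank k (residueGrading 𝒜 t) + F.cycleDim t 0 =
      Module.finrank k (freeDegreePart 𝒜 (F.deg 0) t) := by
  have := finiteDimensional_freeDegreePart (𝒜 := 𝒜) (t := t) (hF 0)
  let ε : (Fin (F.rank 0) → A) →ₗ[k] ResidueModule 𝒜 := F.ε.restrictScalars k
  suffices heq : residueGrading 𝒜 t = (freeDegreePart 𝒜 (F.deg 0) t).map ε by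
    rw [← finrank_map_add_finrank_inf_ker ε, heq]; rfl
  ext m
  constructor
  · intro hm
    obtain ⟨v, rfl⟩ := F.ε_surjective m
    exact ⟨_, freeComponent_mem (F.deg 0) t v,
      isGradedQuotient_residue.map_freeComponent F.ε F.ε_homogeneous hm⟩
  · rintro ⟨v, hv, rfl⟩
    change F.ε v ∈ _
    rw [SetLike.mem_coe, mem_freeDegreePart] at hv
    rw [linearMap_eq_sum]
    refine Submodule.sum_mem _ fun b _ => ?_
    obtain ⟨c, hc, hc'⟩ := F.ε_homogeneous b
    have hb := hv b
    rw [hF, if_pos (Nat.zero_le _)] at hb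
    rw [hF] at hc
    refine ⟨v b * c, SetLike.mul_mem_graded hb hc, ?_⟩
    · rw [← hc']; rfl

theorem cycleDim_add_cycleDim_succ [∀ j, FiniteDimensional k (𝒜 j)]
    (hF : ∀ i b, F.deg i b = i) (t i : ℕ) :
    F.cycleDim t i + F.cycleDim t (i + 1) =
      Module.finrank k (freeDegreePart 𝒜 (F.deg (i + 1)) t) := by
  have := finiteDimensional_freeDegreePart (𝒜 := 𝒜) (t := t) (hF (i + 1))
  suffices heq : (F.cycles i).restrictScalars k ⊓ freeDegreePart 𝒜 (F.deg i) t =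
      (freeDegreePart 𝒜 (F.deg (i + 1)) t).map ((F.d i).restrictScalars k) by
    rw [← finrank_map_add_finrank_inf_ker ((F.d i).restrictScalars k), cycleDim, heq]; rfl
  ext v
  constructor
  · rintro ⟨h1, h2⟩
    have h1' : v ∈ F.cycles i := h1
    rw [← range_d] at h1'
    obtain ⟨x, hx⟩ := h1'
    refine ⟨freeComponent 𝒜 (F.deg (i + 1)) t x, freeComponent_mem _ _ _, ?_⟩
    change F.d i _ = v
    rw [freeComponent_map _ (F.d_homogeneous i), hx, freeComponent_of_mem h2]
  · rintro ⟨x, hx, rfl⟩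
    exact ⟨F.d_mem_cycles i x, map_mem_freeDegreePart _ (F.d_homogeneous i) hx⟩

theorem sum_finrank_eq [∀ j, FiniteDimensional k (𝒜 j)]
    (hF : ∀ i b, F.deg i b = i) (t n : ℕ) :
    ∑ i ∈ Finset.range (n + 1),
      (-1 : ℤ) ^ i * Module.finrank k (freeDegreePart 𝒜 (F.deg i) t) =
    Module.finrank k (residueGrading 𝒜 t) + (-1) ^ n * F.cycleDim t n := by
  induction n with
  | zero => simp [← finrank_add_cycleDim_zero hF]
  | succ n ih =>
    rw [Finset.sum_range_succ, ih, ← cycleDim_add_cycleDim_succ hF]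
    push_cast
    ring

/-- This is the Euler characteristic of each degree `t` strand of the resolution of `k`, where `F_i`
contributes `rank i * dim A_{t-i}`. -/
theorem hilbertSeries_mul_eq_one [Nontrivial A] (h0 : 𝒜 0 = 1) [∀ j, FiniteDimensional k (𝒜 j)]
    (hF : ∀ i b, F.deg i b = i) :
    PowerSeries.evalNegHom (PowerSeries.mk fun i => (F.rank i : ℤ)) * hilbertSeries 𝒜 = 1 := by
  ext t
  -- Truncating at `t + 1` loses nothing: `F_{t+1}` is generated in degree `t + 1`, so it has no
  -- elements of degree `t`.
  have h1 := sum_finrank_eq hF t (t + 1)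
  have h2 : F.cycleDim t (t + 1) = 0 := by
    rw [cycleDim, freeDegreePart_of_lt (hF _) (Nat.lt_succ_self t), inf_bot_eq, finrank_bot]
  rw [h2, Finset.sum_range_succ, finrank_residueGrading h0,
    freeDegreePart_of_lt (hF _) (Nat.lt_succ_self t), finrank_bot] at h1
  rw [PowerSeries.coeff_mul, Finset.Nat.sum_antidiagonal_eq_sum_range_succ_mk,
    PowerSeries.coeff_one]
  simp only [Nat.cast_zero, mul_zero, add_zero, Nat.cast_ite, Nat.cast_one] at h1
  rw [← h1]
  refine Finset.sum_congr rfl fun i hi => ?_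
  rw [finrank_freeDegreePart (hF i), if_pos (by simpa [Nat.lt_succ_iff] using hi),
    PowerSeries.evalNegHom, PowerSeries.coeff_rescale, PowerSeries.coeff_mk, hilbertSeries,
    PowerSeries.coeff_mk]
  push_cast
  ring

end GradedFreeResolution

end LinearResolution

/-! ### Diagonal power series in two variables -/

section DiagonalSeries

open PowerSeries

/-- A series in two variables is diagonal if it is a series in the product of the variables. -/
def IsDiagonal (f : ℤ⟦X⟧⟦X⟧) : Prop := ∀ i j, i ≠ j → coeff j (coeff i f) = 0

/-- The series of diagonal coefficients. -/
def diagonal (f : ℤ⟦X⟧⟦X⟧) : ℤ⟦X⟧ := PowerSeries.mk fun i => coeff i (coeff i f)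

theorem coeff_coeff_mul (f g : ℤ⟦X⟧⟦X⟧) (i j : ℕ) :
    coeff j (coeff i (f * g)) = ∑ p ∈ Finset.HasAntidiagonal.antidiagonal i, ∑ q ∈ Finset.HasAntidiagonal.antidiagonal j,
      coeff q.1 (coeff p.1 f) * coeff q.2 (coeff p.2 g) := by
  rw [coeff_mul, map_sum]
  exact Finset.sum_congr rfl fun p _ => coeff_mul _ _ _

/-- If the first factor contributes only pairs `(a, a)`, then a term at `(n, n)` forces the second
index to be diagonal too, whatever `g` is. -/
theorem IsDiagonal.diagonal_mul {f : ℤ⟦X⟧⟦X⟧} (hf : IsDiagonal f) (g : ℤ⟦X⟧⟦X⟧) :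
    diagonal (f * g) = diagonal f * diagonal g := by
  ext n
  rw [diagonal, coeff_mk, coeff_coeff_mul, coeff_mul]
  refine Finset.sum_congr rfl fun p hp => ?_
  rw [Finset.sum_eq_single p]
  · simp [diagonal]
  · intro q hq hqp
    have : p.1 ≠ q.1 := by
      rw [Finset.HasAntidiagonal.mem_antidiagonal] at hp hq
      intro h
      exact hqp (Prod.ext h.symm (by omega))
    rw [hf _ _ this, zero_mul]
  · intro h; exact absurd hp h

theorem le_coeff_coeff_mul {f g : ℤ⟦X⟧⟦X⟧} (hf : ∀ i j, 0 ≤ coeff j (coeff i f))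
    (hg : ∀ i j, 0 ≤ coeff j (coeff i g)) (h0 : 1 ≤ coeff 0 (coeff 0 f)) (i j : ℕ) :
    coeff j (coeff i g) ≤ coeff j (coeff i (f * g)) := by
  rw [coeff_coeff_mul]
  have h1 : ∀ p ∈ Finset.HasAntidiagonal.antidiagonal i, 0 ≤ ∑ q ∈ Finset.HasAntidiagonal.antidiagonal j,
      coeff q.1 (coeff p.1 f) * coeff q.2 (coeff p.2 g) :=
    fun p _ => Finset.sum_nonneg fun q _ => mul_nonneg (hf _ _) (hg _ _)
  have hi : ((0, i) : ℕ × ℕ) ∈ Finset.HasAntidiagonal.antidiagonal i := by simp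
  have hj : ((0, j) : ℕ × ℕ) ∈ Finset.HasAntidiagonal.antidiagonal j := by simp
  refine le_trans ?_ (Finset.single_le_sum h1 hi)
  refine le_trans ?_ (Finset.single_le_sum (fun q _ => mul_nonneg (hf _ _) (hg _ _)) hj)
  exact le_mul_of_one_le_left (hg _ _) h0

/-- If `f (1 - g) = h` with `f`, `g`, `h` coefficientwise non-negative, and `f` is diagonal with
positive constant term, then `g` and `h` are diagonal. -/
theorem isDiagonal_of_mul_one_sub {f g h : ℤ⟦X⟧⟦X⟧} (hf : ∀ i j, 0 ≤ coeff j (coeff i f))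
    (hg : ∀ i j, 0 ≤ coeff j (coeff i g)) (hh : ∀ i j, 0 ≤ coeff j (coeff i h))
    (h0 : 1 ≤ coeff 0 (coeff 0 f)) (hdiag : IsDiagonal f) (heq : f * (1 - g) = h) :
    IsDiagonal g ∧ IsDiagonal h := by
  -- Off the diagonal this writes `0` as a sum of two non-negative numbers, the second of which
  -- dominates the coefficient of `g`.
  have key : ∀ i j, coeff j (coeff i f) =
      coeff j (coeff i h) + coeff j (coeff i (f * g)) := by
    intro i j
    rw [← heq, mul_sub, mul_one, map_sub, map_sub, sub_add_cancel]
  constructor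
  all_goals
    intro i j hij
    have h1 := key i j
    rw [hdiag i j hij] at h1
    have h2 := le_coeff_coeff_mul hf hg h0 i j
    have h3 := hg i j
    have h4 := hh i j
    omega

theorem evalNegHom_evalNegHom (f : ℤ⟦X⟧) : evalNegHom (evalNegHom f) = f := by
  ext n
  simp only [evalNegHom, coeff_rescale]
  rw [← mul_assoc, ← mul_pow]
  simp

end DiagonalSeries

/-! ### Betti numbers of cyclic modules from minimal resolutions -/

section Betti

variable {k : Type u} [Field k] {A : Type v} [CommRing A] [Algebra k A]
  {𝒜 : ℕ → Submodule k A} [GradedAlgebra 𝒜]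
  {M : Type w} [AddCommGroup M] [Module k M] [Module A M] {ℳ : ℕ → Submodule k M}
  {π : A →ₗ[A] M}

theorem coeff_coeff_poincareSeries (i j : ℕ) :
    PowerSeries.coeff j (PowerSeries.coeff i (poincareSeries 𝒜 ℳ)) = gradedBetti 𝒜 ℳ i j := by
  simp [poincareSeries]

namespace GradedFreeResolution

theorem IsMinimal.gradedBetti_eq [Nontrivial A] (h0 : 𝒜 0 = 1) (hπ : IsGradedQuotient 𝒜 ℳ π)
    {F : GradedFreeResolution 𝒜 ℳ} (hF : F.IsMinimal) (i j : ℕ) :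
    gradedBetti 𝒜 ℳ i j = Fintype.card {b // F.deg i b = j} := by
  rw [gradedBetti_eq_finrank hπ F, hF.finrank_tor h0]

theorem IsMinimal.deg_eq_of_gradedBetti_eq_zero [Nontrivial A] (h0 : 𝒜 0 = 1)
    (hπ : IsGradedQuotient 𝒜 ℳ π) {F : GradedFreeResolution 𝒜 ℳ} (hF : F.IsMinimal) {i t : ℕ}
    (h : ∀ j, j ≠ t → gradedBetti 𝒜 ℳ i j = 0) (b : Fin (F.rank i)) : F.deg i b = t := by
  by_contra hb
  have h1 := h _ hb
  rw [hF.gradedBetti_eq h0 hπ, Fintype.card_eq_zero_iff] at h1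
  exact h1.elim ⟨b, rfl⟩

theorem IsMinimal.gradedBetti_of_deg_eq [Nontrivial A] (h0 : 𝒜 0 = 1)
    (hπ : IsGradedQuotient 𝒜 ℳ π) {F : GradedFreeResolution 𝒜 ℳ} (hF : F.IsMinimal) {i t : ℕ}
    (h : ∀ b, F.deg i b = t) (j : ℕ) :
    gradedBetti 𝒜 ℳ i j = if t = j then F.rank i else 0 := by
  rw [hF.gradedBetti_eq h0 hπ]
  simp only [h]
  split_ifs with hj
  · rw [Fintype.card_subtype]
    simp [hj]
  · simp [hj]

/-- Generators of the kernel of the augmentation of a resolution of a cyclic module. -/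
def relation (F : GradedFreeResolution 𝒜 ℳ) (b₀ : Fin (F.rank 0)) (b : Fin (F.rank 1)) : A :=
  F.d 0 (Pi.single b 1) b₀

omit [GradedAlgebra 𝒜] in
theorem d_zero_apply (F : GradedFreeResolution 𝒜 ℳ) (b₀ : Fin (F.rank 0))
    (v : Fin (F.rank 1) → A) : F.d 0 v b₀ = ∑ b, v b * F.relation b₀ b := by
  rw [linearMap_eq_sum, Finset.sum_apply]
  rfl

omit [GradedAlgebra 𝒜] in
theorem IsCyclicAt.relation_mem {F : GradedFreeResolution 𝒜 ℳ} {b₀ : Fin (F.rank 0)}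
    (h : F.IsCyclicAt π b₀) (b : Fin (F.rank 1)) : F.relation b₀ b ∈ 𝒜 (F.deg 1 b) := by
  have := (mem_freeDegreePart 𝒜).1 (F.d_homogeneous 0 b) b₀
  rwa [h.deg_eq, if_pos (Nat.zero_le _), Nat.sub_zero] at this

omit [GradedAlgebra 𝒜] in
theorem IsCyclicAt.mem_ker_iff {F : GradedFreeResolution 𝒜 ℳ} {b₀ : Fin (F.rank 0)}
    (h : F.IsCyclicAt π b₀) (a : A) : π a = 0 ↔ ∃ v : Fin (F.rank 1) → A, ∑ b, v b * F.relation b₀ b = a := by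
  have h1 := F.exact_zero (fun _ => a)
  rw [h.ε_eq] at h1
  rw [h1]
  constructor
  · rintro ⟨v, hv⟩
    exact ⟨v, by rw [← d_zero_apply, hv]⟩
  · rintro ⟨v, hv⟩
    refine ⟨v, funext fun b => ?_⟩
    rw [h.eq b, d_zero_apply, hv]

omit [GradedAlgebra 𝒜] in
theorem IsCyclicAt.d_zero_eq_zero_iff {F : GradedFreeResolution 𝒜 ℳ} {b₀ : Fin (F.rank 0)}
    (h : F.IsCyclicAt π b₀) (v : Fin (F.rank 1) → A) :
    F.d 0 v = 0 ↔ ∑ b, v b * F.relation b₀ b = 0 := by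
  rw [← d_zero_apply]
  constructor
  · intro hv; rw [hv]; rfl
  · intro hv; exact funext fun b => by rw [h.eq b, hv]; rfl

omit [GradedAlgebra 𝒜] in
theorem IsCyclicAt.deg_zero {F : GradedFreeResolution 𝒜 ℳ} {b₀ : Fin (F.rank 0)}
    (h : F.IsCyclicAt π b₀) (b : Fin (F.rank 0)) : F.deg 0 b = 0 := by
  rw [h.eq b, h.deg_eq]

omit [GradedAlgebra 𝒜] in
theorem IsCyclicAt.rank_zero {F : GradedFreeResolution 𝒜 ℳ} {b₀ : Fin (F.rank 0)}
    (h : F.IsCyclicAt π b₀) : F.rank 0 = 1 := by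
  rw [← Fintype.card_fin (F.rank 0)]
  exact Fintype.card_eq_one_iff.2 ⟨b₀, h.eq⟩

end GradedFreeResolution

end Betti

/-! ### Golod homomorphisms onto Koszul algebras -/

section Golod

open PowerSeries GradedFreeResolution

variable {k : Type u} [Field k] {Q : Type v} [CommRing Q] [Algebra k Q]
    {R : Type w} [CommRing R] [Algebra k R]
    {𝒬 : ℕ → Submodule k Q} [GradedAlgebra 𝒬] {ℛ : ℕ → Submodule k R} [GradedAlgebra ℛ]

theorem gradedAlgHom_proj (φ : 𝒬 →ₐᵍ[k] ℛ) (j : ℕ) (a : Q) :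
    GradedAlgebra.proj ℛ j (φ a) = φ (GradedAlgebra.proj 𝒬 j a) := by
  induction a using DirectSum.Decomposition.inductionOn 𝒬 with
  | zero => simp
  | @homogeneous i a =>
    have h1 : φ a ∈ ℛ i := φ.map_mem a.2
    rcases eq_or_ne i j with rfl | hij
    · rw [proj_of_mem h1, proj_of_mem a.2]
    · rw [proj_of_mem_ne h1 hij, proj_of_mem_ne a.2 hij, map_zero]
  | add x y hx hy => simp only [map_add, hx, hy]

theorem isGradedQuotient_gradedAlgHom [Module Q R] (φ : 𝒬 →ₐᵍ[k] ℛ)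
    (hφ : Function.Surjective φ) (π : Q →ₗ[Q] R) (hπ : ∀ a, π a = φ a) :
    IsGradedQuotient 𝒬 ℛ π where
  surjective r := by
    obtain ⟨a, rfl⟩ := hφ r
    exact ⟨a, hπ a⟩
  proj_mem_ker a j ha := by
    rw [hπ] at ha ⊢
    rw [← gradedAlgHom_proj, ha, map_zero]
  mem_iff j m := by
    constructor
    · intro hm
      obtain ⟨a, rfl⟩ := hφ m
      refine ⟨GradedAlgebra.proj 𝒬 j a, proj_mem j a, ?_⟩
      rw [hπ, ← gradedAlgHom_proj, proj_of_mem hm]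
    · rintro ⟨a, ha, rfl⟩
      rw [hπ]
      exact φ.map_mem ha

/-- The consequences of a Golod homomorphism `Q → R` onto a Koszul algebra: `Q` is Koszul, the
series `N = z (P^Q_R - 1)` is diagonal and its coefficient of degree two is the number of
generators of the kernel. -/
theorem exists_of_isGolod [IsNoetherianRing Q] [Nontrivial Q] [Nontrivial R]
    [∀ j, FiniteDimensional k (𝒬 j)] [∀ j, FiniteDimensional k (ℛ j)]
    (hQ : 𝒬 0 = 1) (hR : ℛ 0 = 1) (hK : IsKoszul ℛ) (φ : 𝒬 →ₐᵍ[k] ℛ) (hφ : IsGolod φ) :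
    (∃ (F : GradedFreeResolution 𝒬 (residueGrading 𝒬)) (b₀ : Fin (F.rank 0)),
      (∀ i b, F.deg i b = i) ∧ F.IsCyclicAt (irrelevantIdeal 𝒬).mkQ b₀) ∧
    ∃ N : ℤ⟦X⟧, (∀ n, 0 ≤ coeff n N) ∧ coeff 0 N = 0 ∧ coeff 1 N = 0 ∧
      (1 - N) * evalNegHom (hilbertSeries 𝒬) = evalNegHom (hilbertSeries ℛ) ∧
      ∃ (μ : ℕ) (y : Fin μ → Q), coeff 2 N = μ ∧ ∀ a, φ a = 0 ↔ ∃ v : Fin μ → Q, ∑ b, v b * y b = a := by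
  let _ : Module Q R := Module.compHom R (φ : Q →ₐ[k] R).toRingHom
  obtain ⟨hsurj, hker, hP⟩ := hφ
  let π : Q →ₗ[Q] R :=
    { toFun := φ
      map_add' := map_add φ
      map_smul' := fun a b => map_mul φ a b }
  have hπ := isGradedQuotient_gradedAlgHom φ hsurj π fun _ => rfl
  obtain ⟨FR, hFR⟩ := hK
  have hFRmin := isMinimal_of_linear hFR
  obtain ⟨FQ, bQ, hFQmin, hFQ⟩ := exists_minimal (𝒜 := 𝒬) hQ isGradedQuotient_residue
    mkQ_irrelevantIdeal_eq_zero
  obtain ⟨G, bG, hGmin, hG⟩ := exists_minimal (𝒜 := 𝒬) hQ hπ fun a ha => by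
    refine Ideal.pow_le_self two_ne_zero (hker ?_)
    exact ha
  set P₁ := poincareSeries ℛ (residueGrading ℛ) with hP₁
  set P₂ := poincareSeries 𝒬 (residueGrading 𝒬) with hP₂
  set T := PowerSeries.X * (poincareSeries 𝒬 ℛ - 1) with hT
  have hc₁ : ∀ i j, coeff j (coeff i P₁) = if i = j then (FR.rank i : ℤ) else 0 := by
    intro i j
    rw [hP₁, coeff_coeff_poincareSeries,
      hFRmin.gradedBetti_of_deg_eq hR isGradedQuotient_residue (hFR i)]
    push_cast; rfl
  have hH₁ := hilbertSeries_mul_eq_one hR hFR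
  -- `FR` is linear but not known to be cyclic; its rank in index zero is nonzero because the rank
  -- series is invertible.
  have hr₁ : (1 : ℤ) ≤ FR.rank 0 := by
    have h1 := congrArg (coeff 0) hH₁
    rw [coeff_mul] at h1
    simp [evalNegHom] at h1
    rcases Nat.eq_zero_or_pos (FR.rank 0) with h2 | h2
    · rw [h2] at h1; simp at h1
    · exact_mod_cast h2
  -- The factor `z` shifts the homological index by one, and subtracting `1` removes the generator
  -- of `G_0 = Q`.
  have hcT : ∀ i j, coeff j (coeff (i + 1) T) =
      (gradedBetti 𝒬 ℛ i j : ℤ) - if i = 0 ∧ j = 0 then 1 else 0 := by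
    intro i j
    rw [hT, coeff_succ_X_mul, map_sub, map_sub, coeff_coeff_poincareSeries, coeff_one]
    congr 1
    split_ifs with h1 h2 h2
    · simp [h2]
    · rw [coeff_one, if_neg (by tauto)]
    · tauto
    · simp
  have hb0 : ∀ j, gradedBetti 𝒬 ℛ 0 j = if 0 = j then 1 else 0 := by
    intro j
    rw [hGmin.gradedBetti_of_deg_eq hQ hπ hG.deg_zero, hG.rank_zero]
  have hTnn : ∀ i j, 0 ≤ coeff j (coeff i T) := by
    rintro (_ | i) j
    · simp [hT]
    · rw [hcT]
      rcases Nat.eq_zero_or_pos i with rfl | hi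
      · rw [hb0]
        simp only [true_and, eq_comm (a := 0)]
        split_ifs <;> simp
      · rw [if_neg (by omega)]; simp
  have hnn₂ : ∀ i j, 0 ≤ coeff j (coeff i P₂) := by
    intro i j; rw [hP₂, coeff_coeff_poincareSeries]; positivity
  have hd₁ : IsDiagonal P₁ := by
    intro i j hij; rw [hc₁, if_neg hij]
  obtain ⟨hdT, hd₂⟩ := isDiagonal_of_mul_one_sub (g := T)
    (fun i j => by rw [hc₁]; split_ifs <;> simp)
    hTnn hnn₂ (by rw [hc₁, if_pos rfl]; exact hr₁) hd₁ hP
  have hFQlin : ∀ i b, FQ.deg i b = i := by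
    intro i b
    refine hFQmin.deg_eq_of_gradedBetti_eq_zero hQ isGradedQuotient_residue ?_ b
    intro j hj
    have := hd₂ i j hj.symm
    rw [hP₂, coeff_coeff_poincareSeries] at this
    exact_mod_cast this
  have hp₁ : diagonal P₁ = PowerSeries.mk fun i => (FR.rank i : ℤ) := by
    ext i; rw [diagonal, coeff_mk, coeff_mk, hc₁, if_pos rfl]
  have hp₂ : diagonal P₂ = PowerSeries.mk fun i => (FQ.rank i : ℤ) := by
    ext i
    rw [diagonal, coeff_mk, coeff_mk, hP₂, coeff_coeff_poincareSeries,
      hFQmin.gradedBetti_of_deg_eq hQ isGradedQuotient_residue (hFQlin i), if_pos rfl]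
  have hH₂ := hilbertSeries_mul_eq_one hQ hFQlin
  have hdiag : diagonal P₁ * (1 - diagonal T) = diagonal P₂ := by
    rw [← hP, mul_sub, mul_sub, mul_one, mul_one, ← hd₁.diagonal_mul]
    ext i; simp [diagonal]
  rw [← hp₁] at hH₁
  rw [← hp₂] at hH₂
  have hE₁ := congrArg evalNegHom hH₁
  have hE₂ := congrArg evalNegHom hH₂
  rw [map_mul, evalNegHom_evalNegHom, map_one] at hE₁ hE₂
  refine ⟨⟨FQ, bQ, hFQlin, hFQ⟩, diagonal T, ?_, ?_, ?_, ?_, G.rank 1, G.relation bG, ?_, hG.mem_ker_iff⟩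
  · intro n; rw [diagonal, coeff_mk]; exact hTnn n n
  · rw [diagonal, coeff_mk]; simp [hT]
  · rw [diagonal, coeff_mk, hcT, hb0]; simp
  -- After `z ↦ -z`, the diagonals of `P₁` and `P₂` are inverse to `H_R(-z)` and `H_Q(-z)`, so the
  -- Golod identity on the diagonal becomes one between Hilbert series.
  · have h3 : (diagonal P₁ * evalNegHom (hilbertSeries ℛ)) *
        ((1 - diagonal T) * evalNegHom (hilbertSeries 𝒬)) = evalNegHom (hilbertSeries ℛ) *
        ((diagonal P₁ * (1 - diagonal T)) * evalNegHom (hilbertSeries 𝒬)) := by ring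
    rwa [hE₁, one_mul, hdiag, hE₂, mul_one] at h3
  -- First syzygies of `R` over `Q` sit at `z^2` in `T` because of the shift, so diagonality puts
  -- the kernel generators in degree two.
  · have hdeg : ∀ b, G.deg 1 b = 2 := by
      intro b
      refine hGmin.deg_eq_of_gradedBetti_eq_zero hQ hπ ?_ b
      intro j hj
      have := hdT 2 j hj.symm
      rw [hcT] at this
      simpa using this
    rw [diagonal, coeff_mk, hcT, hGmin.gradedBetti_of_deg_eq hQ hπ hdeg]
    simp

end Golod

/-! ### Polynomial rings: Hilbert series and graded maps -/

section PolynomialHilbert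

open MvPolynomial

variable {k : Type u} [Field k]

theorem finrank_homogeneousSubmodule (n j : ℕ) :
    Module.finrank k (homogeneousSubmodule (Fin n) k j) = n.multichoose j := by
  rw [homogeneousSubmodule_eq_finsupp_supported,
    (AddMonoidAlgebra.supportedEquivFinsupp {d : Fin n →₀ ℕ | d.degree = j}).finrank_eq]
  have hset : {d : Fin n →₀ ℕ | d.degree = j} =
      ((Finset.univ : Finset (Fin n)).finsuppAntidiag j : Set (Fin n →₀ ℕ)) := by
    ext d
    simp [Finset.mem_finsuppAntidiag, Finsupp.degree_eq_sum]
  rw [hset, Module.finrank_finsupp_self, Fintype.card_eq_nat_card, Nat.card_coe_set_eq,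
    Set.ncard_coe_finset,
    Finset.card_finsuppAntidiag_nat_eq_multichoose, Finset.card_univ, Fintype.card_fin]

theorem one_sub_pow_mul_hilbertSeries (n : ℕ) :
    (1 - PowerSeries.X) ^ n * hilbertSeries (homogeneousSubmodule (Fin n) k) = 1 := by
  have h1 : hilbertSeries (homogeneousSubmodule (Fin n) k) =
      (PowerSeries.invOneSubPow ℤ n : ℤ⟦X⟧) := by
    ext j
    rw [hilbertSeries, PowerSeries.coeff_mk, finrank_homogeneousSubmodule]
    cases n with
    | zero => cases j <;> simp [PowerSeries.invOneSubPow_zero, PowerSeries.coeff_one]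
    | succ n =>
      rw [PowerSeries.invOneSubPow_val_succ_eq_mk_add_choose, PowerSeries.coeff_mk,
        Nat.multichoose_eq, Nat.choose_symm_add]
      congr 2
      omega
  rw [h1, ← PowerSeries.invOneSubPow_inv_eq_one_sub_pow]
  exact Units.inv_mul _

instance finiteDimensional_homogeneousSubmodule (n j : ℕ) :
    FiniteDimensional k (homogeneousSubmodule (Fin n) k j) :=
  Module.Finite.iff_fg.2 (homogeneousSubmodule_fg _ _ j)

variable {A : Type v} [CommRing A] [Algebra k A] (𝒜 : ℕ → Submodule k A) [GradedAlgebra 𝒜]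

theorem aeval_mem_of_isHomogeneous {n : ℕ} (π : MvPolynomial (Fin n) k →ₐ[k] A)
    (hX : ∀ i, π (X i) ∈ 𝒜 1) {j : ℕ} {p : MvPolynomial (Fin n) k} (hp : p.IsHomogeneous j) :
    π p ∈ 𝒜 j := by
  rw [p.as_sum, map_sum]
  refine Submodule.sum_mem _ fun d hd => ?_
  have hdeg : d.degree = j := by
    rw [Finsupp.degree_eq_weight_one]
    exact hp (mem_support_iff.1 hd)
  rw [monomial_eq, map_mul, Finsupp.prod, map_prod, ← algebraMap_eq, AlgHom.commutes]
  have h1 : ∏ i ∈ d.support, π (X i ^ d i) ∈ 𝒜 (∑ i ∈ d.support, d i) := by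
    refine SetLike.prod_mem_graded _ _ _ fun i _ => ?_
    rw [map_pow]
    have := SetLike.pow_mem_graded (d i) (hX i)
    rwa [smul_eq_mul, mul_one] at this
  rw [← hdeg, Finsupp.degree_apply, ← Algebra.smul_def]
  exact Submodule.smul_mem _ _ h1

attribute [local instance] MvPolynomial.gradedAlgebra

/-- An algebra map from a polynomial ring sending variables to degree one, as a graded map. -/
def gradedAlgHomOfX {n : ℕ} (π : MvPolynomial (Fin n) k →ₐ[k] A)
    (hX : ∀ i, π (X i) ∈ 𝒜 1) : homogeneousSubmodule (Fin n) k →ₐᵍ[k] 𝒜 :=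
  { π with map_mem := fun {_ _} h => aeval_mem_of_isHomogeneous 𝒜 π hX h }

end PolynomialHilbert

/-! ### Hilbert series modulo a regular sequence -/

section IdealHilbert

variable {k : Type u} [Field k] {A : Type v} [CommRing A] [Algebra k A]
  (𝒜 : ℕ → Submodule k A)

/-- The degree `j` part of an ideal. -/
def idealPart (I : Ideal A) (j : ℕ) : Submodule k A := I.restrictScalars k ⊓ 𝒜 j

/-- The Hilbert series of `A / I` for a homogeneous ideal `I`. -/
def quotientHilbertSeries (I : Ideal A) : ℤ⟦X⟧ :=
  PowerSeries.mk fun j => (Module.finrank k (𝒜 j) : ℤ) - Module.finrank k (idealPart 𝒜 I j)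

instance finiteDimensional_idealPart [∀ j, FiniteDimensional k (𝒜 j)] (I : Ideal A) (j : ℕ) :
    FiniteDimensional k (idealPart 𝒜 I j) :=
  Submodule.finiteDimensional_inf_right _ _

theorem quotientHilbertSeries_bot : quotientHilbertSeries 𝒜 ⊥ = hilbertSeries 𝒜 := by
  ext j
  have : idealPart 𝒜 ⊥ j = ⊥ := by
    rw [eq_bot_iff]
    exact fun x hx => hx.1
  rw [quotientHilbertSeries, hilbertSeries, PowerSeries.coeff_mk, PowerSeries.coeff_mk, this,
    finrank_bot]
  simp

variable [GradedAlgebra 𝒜] {𝒜}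

theorem gradedAlgHom_map_eq {B : Type w} [CommRing B] [Algebra k B] {ℬ : ℕ → Submodule k B}
    [GradedAlgebra ℬ] (φ : 𝒜 →ₐᵍ[k] ℬ) (hφ : Function.Surjective φ) (j : ℕ) :
    (𝒜 j).map (φ : A →ₐ[k] B).toLinearMap = ℬ j := by
  ext b
  constructor
  · rintro ⟨a, ha, rfl⟩; exact φ.map_mem ha
  · intro hb
    obtain ⟨a, rfl⟩ := hφ b
    refine ⟨GradedAlgebra.proj 𝒜 j a, proj_mem j a, ?_⟩
    change φ _ = φ a
    rw [← gradedAlgHom_proj, proj_of_mem hb]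

theorem finiteDimensional_of_surjective {B : Type w} [CommRing B] [Algebra k B]
    {ℬ : ℕ → Submodule k B} [GradedAlgebra ℬ] [∀ j, FiniteDimensional k (𝒜 j)]
    (φ : 𝒜 →ₐᵍ[k] ℬ) (hφ : Function.Surjective φ) (j : ℕ) : FiniteDimensional k (ℬ j) := by
  rw [← gradedAlgHom_map_eq φ hφ j]
  infer_instance

theorem finrank_add_finrank_idealPart {B : Type w} [CommRing B] [Algebra k B]
    {ℬ : ℕ → Submodule k B} [GradedAlgebra ℬ] [∀ j, FiniteDimensional k (𝒜 j)]
    (φ : 𝒜 →ₐᵍ[k] ℬ) (hφ : Function.Surjective φ) {I : Ideal A} (hI : ∀ a, a ∈ I ↔ φ a = 0)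
    (j : ℕ) :
    Module.finrank k (ℬ j) + Module.finrank k (idealPart 𝒜 I j) = Module.finrank k (𝒜 j) := by
  rw [← finrank_map_add_finrank_inf_ker (φ : A →ₐ[k] B).toLinearMap (𝒜 j), gradedAlgHom_map_eq φ hφ]
  have : idealPart 𝒜 I j = LinearMap.ker (φ : A →ₐ[k] B).toLinearMap ⊓ 𝒜 j := by
    ext a
    exact and_congr (hI a) Iff.rfl
  rw [this]

theorem hilbertSeries_eq_quotientHilbertSeries {B : Type w} [CommRing B] [Algebra k B]
    {ℬ : ℕ → Submodule k B} [GradedAlgebra ℬ] [∀ j, FiniteDimensional k (𝒜 j)]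
    (φ : 𝒜 →ₐᵍ[k] ℬ) (hφ : Function.Surjective φ) {I : Ideal A} (hI : ∀ a, a ∈ I ↔ φ a = 0) :
    hilbertSeries ℬ = quotientHilbertSeries 𝒜 I := by
  ext j
  rw [hilbertSeries, quotientHilbertSeries, PowerSeries.coeff_mk, PowerSeries.coeff_mk,
    ← finrank_add_finrank_idealPart φ hφ hI j]
  simp

/-- An ideal closed under taking homogeneous components. -/
def IsGradedIdeal (𝒜 : ℕ → Submodule k A) [GradedAlgebra 𝒜] (I : Ideal A) : Prop :=
  ∀ a ∈ I, ∀ j, GradedAlgebra.proj 𝒜 j a ∈ I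

theorem IsGradedIdeal.sup_span_singleton {I : Ideal A} (hI : IsGradedIdeal 𝒜 I) {f : A} {d : ℕ}
    (hf : f ∈ 𝒜 d) : IsGradedIdeal 𝒜 (I ⊔ Ideal.span {f}) := by
  intro a ha j
  obtain ⟨x, hx, y, hy, rfl⟩ := Submodule.mem_sup.1 ha
  obtain ⟨s, rfl⟩ := Ideal.mem_span_singleton'.1 hy
  rw [map_add, proj_mul_of_mem s hf]
  refine Submodule.add_mem_sup (hI x hx j) ?_
  split_ifs
  · exact Ideal.mul_mem_left _ _ (Ideal.mem_span_singleton_self f)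
  · exact zero_mem _

/-- Multiplication by `f` embeds `A / I`, shifted by `d`, into `A / I` with cokernel `A / (I +
(f))`. -/
theorem quotientHilbertSeries_sup_span_singleton [∀ j, FiniteDimensional k (𝒜 j)] {I : Ideal A}
    (hI : IsGradedIdeal 𝒜 I) {f : A} {d : ℕ} (hf : f ∈ 𝒜 d) (hreg : ∀ s, s * f ∈ I → s ∈ I) :
    quotientHilbertSeries 𝒜 (I ⊔ Ideal.span {f}) =
      quotientHilbertSeries 𝒜 I * (1 - PowerSeries.X ^ d) := by
  have hmem : ∀ a ∈ I ⊔ Ideal.span {f}, ∀ j, a ∈ 𝒜 j →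
      a ∈ I ∨ (d ≤ j ∧ ∃ s ∈ 𝒜 (j - d), a - s * f ∈ I) := by
    intro a ha j haj
    obtain ⟨x, hx, y, hy, rfl⟩ := Submodule.mem_sup.1 ha
    obtain ⟨s, rfl⟩ := Ideal.mem_span_singleton'.1 hy
    have h1 := proj_of_mem haj
    rw [map_add, proj_mul_of_mem s hf] at h1
    rw [← h1]
    split_ifs with hd
    · exact Or.inr ⟨hd, _, proj_mem (𝒜 := 𝒜) (j - d) s, by
        rw [add_sub_cancel_right]; exact hI x hx j⟩
    · rw [add_zero]; exact Or.inl (hI x hx j)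
  ext j
  rw [mul_sub, mul_one, map_sub, PowerSeries.coeff_mul_X_pow']
  simp only [quotientHilbertSeries, PowerSeries.coeff_mk]
  by_cases hd : d ≤ j
  · rw [if_pos hd]
    let mk := (Ideal.Quotient.mkₐ k I).toLinearMap
    have hmk : ∀ a, mk a = 0 ↔ a ∈ I := fun a => Ideal.Quotient.eq_zero_iff_mem
    have hker : ∀ J : Submodule k A, LinearMap.ker mk ⊓ J = I.restrictScalars k ⊓ J := by
      intro J; ext a; exact and_congr (hmk a) Iff.rfl
    -- Rank-nullity for two maps with the same image in `A / I`: reduction of `(I + (f))_j`, and `s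
    -- ↦ s f` on `A_{j-d}`.
    have h1 := finrank_map_add_finrank_inf_ker mk (idealPart 𝒜 (I ⊔ Ideal.span {f}) j)
    have h2 := finrank_map_add_finrank_inf_ker (mk ∘ₗ LinearMap.mulRight k f) (𝒜 (j - d))
    have h3 : LinearMap.ker mk ⊓ idealPart 𝒜 (I ⊔ Ideal.span {f}) j = idealPart 𝒜 I j := by
      ext a
      constructor
      · rintro ⟨ha, ha'⟩; exact ⟨(hmk a).1 ha, ha'.2⟩
      · rintro ⟨ha, ha'⟩
        exact ⟨(hmk a).2 ha, Submodule.mem_sup_left (show a ∈ I from ha), ha'⟩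
    have h4 : LinearMap.ker (mk ∘ₗ LinearMap.mulRight k f) ⊓ 𝒜 (j - d) =
        idealPart 𝒜 I (j - d) := by
      ext a
      refine and_congr ?_ Iff.rfl
      exact (hmk (a * f)).trans ⟨hreg a, fun h => I.mul_mem_right f h⟩
    have h5 : (idealPart 𝒜 (I ⊔ Ideal.span {f}) j).map mk =
        (𝒜 (j - d)).map (mk ∘ₗ LinearMap.mulRight k f) := by
      ext y
      constructor
      · rintro ⟨a, ⟨ha, haj⟩, rfl⟩
        rcases hmem a ha j haj with h | ⟨_, s, hs, hs'⟩
        · exact ⟨0, zero_mem _, by rw [map_zero, (hmk a).2 h]⟩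
        · refine ⟨s, hs, ?_⟩
          have := (hmk _).2 hs'
          rw [map_sub, sub_eq_zero] at this
          exact this.symm
      · rintro ⟨s, hs, rfl⟩
        refine ⟨s * f, ⟨?_, ?_⟩, rfl⟩
        · exact Submodule.mem_sup_right
            (Ideal.mul_mem_left _ s (Ideal.mem_span_singleton_self f))
        · have := SetLike.mul_mem_graded hs hf
          rwa [Nat.sub_add_cancel hd] at this
    rw [h3, h5] at h1
    rw [h4] at h2
    rw [← h1, ← h2]
    push_cast
    ring
  · rw [if_neg hd, sub_zero]
    have : idealPart 𝒜 (I ⊔ Ideal.span {f}) j = idealPart 𝒜 I j := by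
      ext a
      constructor
      · rintro ⟨ha, haj⟩
        rcases hmem a ha j haj with h | h
        · exact ⟨h, haj⟩
        · exact absurd h.1 hd
      · rintro ⟨ha, haj⟩
        exact ⟨Submodule.mem_sup_left (show a ∈ I from ha), haj⟩
    rw [this]

theorem ofList_take_succ (fs : List A) (i : ℕ) (hi : i < fs.length) :
    Ideal.ofList (fs.take (i + 1)) = Ideal.ofList (fs.take i) ⊔ Ideal.span {fs[i]} := by
  rw [List.take_succ_eq_append_getElem hi, Ideal.ofList_append, Ideal.ofList_singleton]

theorem mem_ofList_take_of_mul_mem {fs : List A}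
    (hreg : RingTheory.Sequence.IsWeaklyRegular A fs) (i : ℕ) (hi : i < fs.length) (s : A)
    (hs : s * fs[i] ∈ Ideal.ofList (fs.take i)) : s ∈ Ideal.ofList (fs.take i) := by
  have h1 := hreg.regular_mod_prev i hi
  rw [isSMulRegular_iff_right_eq_zero_of_smul] at h1
  have h2 := h1 (Submodule.Quotient.mk s) (by
    rw [← Submodule.Quotient.mk_smul, Submodule.Quotient.mk_eq_zero, smul_eq_mul, smul_eq_mul,
      Ideal.mul_top, mul_comm]
    exact hs)
  rwa [Submodule.Quotient.mk_eq_zero, smul_eq_mul, Ideal.mul_top] at h2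

theorem quotientHilbertSeries_ofList [∀ j, FiniteDimensional k (𝒜 j)] {fs : List A}
    (hreg : RingTheory.Sequence.IsWeaklyRegular A fs) (d : Fin fs.length → ℕ)
    (hd : ∀ i, fs[i] ∈ 𝒜 (d i)) :
    quotientHilbertSeries 𝒜 (Ideal.ofList fs) =
      hilbertSeries 𝒜 * ∏ i, (1 - PowerSeries.X ^ d i) := by
  -- Homogeneity of the ideal generated by the prefix is carried along, since adding the next
  -- element requires it.
  have key : ∀ m, ∀ hm : m ≤ fs.length, IsGradedIdeal 𝒜 (Ideal.ofList (fs.take m)) ∧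
      quotientHilbertSeries 𝒜 (Ideal.ofList (fs.take m)) =
        hilbertSeries 𝒜 * ∏ i : Fin m, (1 - PowerSeries.X ^ d (i.castLE hm)) := by
    intro m
    induction m with
    | zero =>
      intro _
      simp only [List.take_zero, Ideal.ofList_nil]
      refine ⟨fun a ha j => ?_, ?_⟩
      · rw [Ideal.mem_bot] at ha ⊢
        rw [ha, map_zero]
      · simp [quotientHilbertSeries_bot]
    | succ m ih =>
      intro hm
      obtain ⟨h1, h2⟩ := ih (by omega)
      rw [ofList_take_succ fs m (by omega)]
      refine ⟨h1.sup_span_singleton (hd ⟨m, hm⟩), ?_⟩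
      have hf : fs[m] ∈ 𝒜 (d ⟨m, hm⟩) := hd ⟨m, hm⟩
      rw [quotientHilbertSeries_sup_span_singleton h1 hf
        (mem_ofList_take_of_mul_mem hreg m hm), h2, Fin.prod_univ_castSucc, mul_assoc]
      rfl
  have := (key fs.length le_rfl).2
  rwa [List.take_length] at this

end IdealHilbert

/-! ### Koszul algebras are quadratic -/

section Quadratic

open MvPolynomial GradedFreeResolution

attribute [local instance] MvPolynomial.gradedAlgebra

variable {k : Type u} [Field k]

theorem exists_eq_sum_X_mul {n j : ℕ} {p : MvPolynomial (Fin n) k} (hp : p.IsHomogeneous (j + 1)) :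
    ∃ g : Fin n → MvPolynomial (Fin n) k, (∀ b, (g b).IsHomogeneous j) ∧
      p = ∑ b, X b * g b := by
  have h1 : p ∈ homogeneousSubmodule (Fin n) k 1 * homogeneousSubmodule (Fin n) k j := by
    rw [← homogeneousSubmodule_one_pow k j, ← pow_succ', homogeneousSubmodule_one_pow]
    exact hp
  clear hp
  induction h1 using Submodule.mul_induction_on' with
  | mem_mul_mem x hx y hy =>
    rw [homogeneousSubmodule_one_eq_span_X] at hx
    obtain ⟨c, rfl⟩ := (Submodule.mem_span_range_iff_exists_fun k).1 hx
    refine ⟨fun b => c b • y, fun b => (homogeneousSubmodule (Fin n) k j).smul_mem _ hy, ?_⟩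
    rw [Finset.sum_mul]
    exact Finset.sum_congr rfl fun b _ => by rw [smul_mul_assoc, mul_smul_comm]
  | add x _ y _ hx hy =>
    obtain ⟨g, hg, hxg⟩ := hx
    obtain ⟨g', hg', hyg⟩ := hy
    refine ⟨g + g', fun b => (hg b).add (hg' b), ?_⟩
    simp only [Pi.add_apply, mul_add, Finset.sum_add_distrib, ← hxg, ← hyg]

variable {Q : Type v} [CommRing Q] [Algebra k Q] {𝒬 : ℕ → Submodule k Q} [GradedAlgebra 𝒬]
  {F : GradedFreeResolution 𝒬 (residueGrading 𝒬)} {b₀ : Fin (F.rank 0)}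

theorem relation_mem_one (hF : ∀ i b, F.deg i b = i)
    (hc : F.IsCyclicAt (irrelevantIdeal 𝒬).mkQ b₀) (b : Fin (F.rank 1)) :
    F.relation b₀ b ∈ 𝒬 1 := by
  have := hc.relation_mem b
  rwa [hF] at this

/-- The linear forms `F.relation b₀` generate `Q_{≥ 1}` as an ideal; comparing degree one parts,
they span `Q_1` over `k`, and `Q_1` generates `Q`. -/
theorem aeval_relation_surjective (h0 : 𝒬 0 = 1) (hgen : Algebra.adjoin k (𝒬 1 : Set Q) = ⊤)
    (hF : ∀ i b, F.deg i b = i) (hc : F.IsCyclicAt (irrelevantIdeal 𝒬).mkQ b₀) :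
    Function.Surjective (aeval (R := k) (F.relation b₀)) := by
  rw [← AlgHom.range_eq_top, eq_top_iff, ← hgen]
  refine Algebra.adjoin_le fun a ha => ?_
  have h1 : (irrelevantIdeal 𝒬).mkQ a = 0 := by
    rw [Submodule.mkQ_apply, Submodule.Quotient.mk_eq_zero]
    exact mem_irrelevantIdeal_of_mem one_ne_zero ha
  obtain ⟨v, hv⟩ := (hc.mem_ker_iff a).1 h1
  have h2 := congrArg (GradedAlgebra.proj 𝒬 1) hv
  rw [proj_of_mem ha, map_sum] at h2
  rw [SetLike.mem_coe, ← h2]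
  refine Subalgebra.sum_mem _ fun b _ => ?_
  rw [proj_mul_of_mem _ (relation_mem_one hF hc b), if_pos le_rfl]
  obtain ⟨c, hcc⟩ := exists_algebraMap_of_mem_zero h0 (proj_mem (𝒜 := 𝒬) (1 - 1) (v b))
  rw [← hcc]
  exact ⟨C c * X b, by simp⟩

/-- The defining ideal of a Koszul algebra is generated by quadrics. -/
theorem ker_aeval_relation_eq_span [Nontrivial Q] (h0 : 𝒬 0 = 1)
    (hgen : Algebra.adjoin k (𝒬 1 : Set Q) = ⊤)
    (hF : ∀ i b, F.deg i b = i) (hc : F.IsCyclicAt (irrelevantIdeal 𝒬).mkQ b₀) :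
    RingHom.ker (aeval (R := k) (F.relation b₀)) =
      Ideal.span (idealPart (homogeneousSubmodule (Fin (F.rank 1)) k)
        (RingHom.ker (aeval (R := k) (F.relation b₀))) 2) := by
  set π := aeval (R := k) (F.relation b₀) with hπ
  set J := RingHom.ker π with hJ
  have hX : ∀ b, π (X b) ∈ 𝒬 1 := fun b => by
    rw [hπ, aeval_X]; exact relation_mem_one hF hc b
  let φ := gradedAlgHomOfX 𝒬 π hX
  have hφ : Function.Surjective φ := aeval_relation_surjective h0 hgen hF hc
  have hlift : ∀ {j : ℕ} {a : Q}, a ∈ 𝒬 j → ∃ p : MvPolynomial (Fin (F.rank 1)) k,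
      p.IsHomogeneous j ∧ π p = a := by
    intro j a ha
    rw [← gradedAlgHom_map_eq φ hφ j] at ha
    obtain ⟨p, hp, rfl⟩ := ha
    exact ⟨p, hp, rfl⟩
  refine le_antisymm ?_ (Ideal.span_le.2 fun p hp => hp.1)
  -- Induction on degree. A relation `∑ X_b g_b` in `J` gives a cycle `(g_b)` of `F_1`, hence a
  -- combination of linear syzygies. Subtracting lifts of these leaves elements of `J` of lower
  -- degree, and each linear syzygy contributes a quadric of `J`.
  have key : ∀ j p, p.IsHomogeneous j → p ∈ J →
      p ∈ Ideal.span (idealPart (homogeneousSubmodule (Fin (F.rank 1)) k) J 2 : Set _) := by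
    intro j
    induction j with
    | zero =>
      intro p hp hpJ
      obtain ⟨c, rfl⟩ : ∃ c : k, algebraMap k _ c = p :=
        Submodule.mem_one.1 (homogeneousSubmodule_zero (σ := Fin (F.rank 1)) (R := k) ▸ hp)
      have h1 : algebraMap k Q c = 0 := by
        have : π (algebraMap k _ c) = 0 := hpJ
        rwa [AlgHom.commutes] at this
      rw [(map_eq_zero_iff _ (algebraMap k Q).injective).1 h1, map_zero]
      exact zero_mem _
    | succ j ih =>
      intro p hp hpJ
      obtain ⟨g, hg, rfl⟩ := exists_eq_sum_X_mul hp
      have h1 : F.d 0 (fun b => π (g b)) = 0 := by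
        rw [hc.d_zero_eq_zero_iff]
        have : π (∑ b, X b * g b) = 0 := hpJ
        rw [map_sum] at this
        rw [← this]
        refine Finset.sum_congr rfl fun b _ => ?_
        rw [map_mul, mul_comm, hπ, aeval_X]
      have hgmem : (fun b => π (g b)) ∈ freeDegreePart 𝒬 (F.deg 1) (j + 1) := by
        rw [mem_freeDegreePart]
        intro b
        rw [hF, if_pos (by omega)]
        exact aeval_mem_of_isHomogeneous 𝒬 π hX (hg b)
      obtain ⟨w₀, hw₀⟩ := (F.exact_succ 0 _).1 h1
      set w := freeComponent 𝒬 (F.deg 2) (j + 1) w₀ with hw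
      have h2 : F.d 1 w = fun b => π (g b) := by
        rw [hw, freeComponent_map _ (F.d_homogeneous 1), hw₀, freeComponent_of_mem hgmem]
      have hwmem := (mem_freeDegreePart 𝒬).1 (freeComponent_mem (𝒜 := 𝒬) (F.deg 2) (j + 1) w₀)
      rw [← hw] at hwmem
      -- The coefficient `w c` has degree `j + 1 - 2`; for `j = 0` there is no such degree and `w c
      -- = 0`. Stating homogeneity for the products `W * l` covers both cases.
      have hW : ∀ c, ∃ W : MvPolynomial (Fin (F.rank 1)) k, π W = w c ∧
          ∀ l : MvPolynomial (Fin (F.rank 1)) k, l.IsHomogeneous 1 →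
            (W * l).IsHomogeneous j := by
        intro c
        have h3 := hwmem c
        rw [hF] at h3
        split_ifs at h3 with hj
        · obtain ⟨W, hW, hW'⟩ := hlift h3
          refine ⟨W, hW', fun l hl => ?_⟩
          have := hW.mul hl
          rwa [show j + 1 - 2 + 1 = j by omega] at this
        · refine ⟨0, by rw [map_zero, (Submodule.mem_bot k).1 h3], fun l _ => ?_⟩
          rw [zero_mul]; exact isHomogeneous_zero _ _ _
      choose W hWπ hWl using hW
      have hl : ∀ c b, ∃ l : MvPolynomial (Fin (F.rank 1)) k, l.IsHomogeneous 1 ∧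
          π l = F.d 1 (Pi.single c 1) b := by
        intro c b
        have h3 := (mem_freeDegreePart 𝒬).1 (F.d_homogeneous 1 c) b
        rw [hF, hF, if_pos (by omega)] at h3
        exact hlift h3
      choose l hl hlπ using hl
      have h4 : ∀ b, g b - ∑ c, W c * l c b ∈ Ideal.span
          (idealPart (homogeneousSubmodule (Fin (F.rank 1)) k) J 2 : Set _) := by
        intro b
        refine ih _ ((hg b).sub (IsHomogeneous.sum _ _ _ fun c _ => hWl c _ (hl c b))) ?_
        have h5 := congrFun h2 b
        rw [linearMap_eq_sum, Finset.sum_apply] at h5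
        rw [hJ, RingHom.mem_ker, map_sub, map_sum, sub_eq_zero, ← h5]
        refine Finset.sum_congr rfl fun c _ => ?_
        rw [map_mul, hWπ, hlπ]; rfl
      have h5 : ∀ c, ∑ b, X b * l c b ∈ Ideal.span
          (idealPart (homogeneousSubmodule (Fin (F.rank 1)) k) J 2 : Set _) := by
        intro c
        refine Ideal.subset_span ⟨?_, ?_⟩
        · change π _ = 0
          have h6 : F.d 0 (F.d 1 (Pi.single c 1)) = 0 := F.d_mem_cycles 1 _
          rw [hc.d_zero_eq_zero_iff] at h6
          rw [map_sum, ← h6]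
          refine Finset.sum_congr rfl fun b _ => ?_
          rw [map_mul, hlπ, mul_comm, hπ, aeval_X]
        · exact IsHomogeneous.sum _ _ _ fun b _ => (isHomogeneous_X k b).mul (hl c b)
      have h6 : ∑ b, X b * g b =
          ∑ b, X b * (g b - ∑ c, W c * l c b) + ∑ c, W c * ∑ b, X b * l c b := by
        simp only [mul_sub, Finset.sum_sub_distrib, Finset.mul_sum]
        rw [Finset.sum_comm (f := fun c b => W c * (X b * l c b)), eq_comm, sub_add_eq_add_sub,
          sub_eq_iff_eq_add]
        congr 1
        refine Finset.sum_congr rfl fun b _ => Finset.sum_congr rfl fun c _ => by ring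
      rw [h6]
      exact add_mem (Ideal.sum_mem _ fun b _ => Ideal.mul_mem_left _ _ (h4 b))
        (Ideal.sum_mem _ fun c _ => Ideal.mul_mem_left _ _ (h5 c))
  intro p hp
  rw [← sum_homogeneousComponent p]
  refine Ideal.sum_mem _ fun j _ => key j _ (homogeneousComponent_isHomogeneous j p) ?_
  have h1 := gradedAlgHom_proj φ j p
  have h2 : GradedAlgebra.proj (homogeneousSubmodule (Fin (F.rank 1)) k) j p =
      homogeneousComponent j p := by
    rw [GradedAlgebra.proj_apply]
    exact decomposition.decompose'_apply p j
  have h3 : φ p = 0 := hp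
  rw [h2, h3, map_zero] at h1
  exact h1.symm

end Quadratic

/-! ### Krull dimension bounds -/

section Dimension

open MvPolynomial

variable {k : Type u} [Field k]

/-- The kernel of the specialization of the first `i` variables to zero has height at least `i`. -/
theorem le_height_ker_specialization (n i : ℕ) (hi : i ≤ n) :
    (i : ℕ∞) ≤ (RingHom.ker (aeval (R := k) fun b : Fin n =>
      if (b : ℕ) < i then (0 : MvPolynomial (Fin n) k) else X b)).height := by
  induction i with
  | zero => simp
  | succ i ih =>
    set φ := aeval (R := k) fun b : Fin n =>
      if (b : ℕ) < i then (0 : MvPolynomial (Fin n) k) else X b with hφ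
    set ψ := aeval (R := k) fun b : Fin n =>
      if (b : ℕ) < i + 1 then (0 : MvPolynomial (Fin n) k) else X b with hψ
    -- This gives the inclusion of the two kernels; both are prime because the target is a domain,
    -- and `X_i` separates them.
    have hcomp : ψ.comp φ = ψ := by
      refine algHom_ext fun b => ?_
      rw [AlgHom.comp_apply, hφ, aeval_X]
      split_ifs with h
      · rw [map_zero, hψ, aeval_X, if_pos (by omega)]
      · rfl
    have hφX : φ (X ⟨i, hi⟩) ≠ 0 := by
      rw [hφ, aeval_X, if_neg (by simp)]
      exact X_ne_zero _
    have hψX : ψ (X ⟨i, hi⟩) = 0 := by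
      rw [hψ, aeval_X, if_pos (by simp)]
    have h1 : (RingHom.ker φ).IsPrime := RingHom.ker_isPrime φ
    have h2 : (RingHom.ker ψ).IsPrime := RingHom.ker_isPrime ψ
    have hlt : RingHom.ker φ < RingHom.ker ψ := by
      refine lt_of_le_of_ne (fun p hp => ?_) fun h => ?_
      · rw [RingHom.mem_ker] at hp ⊢
        rw [← hcomp, AlgHom.comp_apply, hp, map_zero]
      · have h3 : X ⟨i, hi⟩ ∈ RingHom.ker φ := by rw [h]; exact hψX
        exact hφX h3
    have h3 := Ideal.height_add_one_le_of_lt_of_isPrime hlt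
    push_cast
    exact le_trans (by gcongr; exact ih (by omega)) h3

theorem le_height_ker_constantCoeff (n : ℕ) :
    (n : ℕ∞) ≤ (RingHom.ker (constantCoeff : MvPolynomial (Fin n) k →+* k)).height := by
  refine le_trans (le_height_ker_specialization (k := k) n n le_rfl) (Ideal.height_mono ?_)
  intro p hp
  rw [RingHom.mem_ker] at hp ⊢
  have h1 : (fun b : Fin n => if (b : ℕ) < n then (0 : MvPolynomial (Fin n) k) else X b) =
      fun _ => 0 := by
    ext b; simp
  rw [h1, aeval_zero'] at hp
  exact (map_eq_zero_iff _ (algebraMap k (MvPolynomial (Fin n) k)).injective).1 hp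

/-- Krull's height theorem for quotients of polynomial rings by ideals that vanish at the
origin. -/
theorem le_ringKrullDim_add_of_surjective {n r : ℕ} {B : Type v} [CommRing B]
    (f : MvPolynomial (Fin n) k →+* B) (hf : Function.Surjective f)
    (z : Fin r → MvPolynomial (Fin n) k) (hz : RingHom.ker f = Ideal.span (Set.range z))
    (hker : RingHom.ker f ≤ RingHom.ker (constantCoeff : MvPolynomial (Fin n) k →+* k)) :
    (n : WithBot ℕ∞) ≤ ringKrullDim B + r := by
  have h1 : (RingHom.ker (constantCoeff : MvPolynomial (Fin n) k →+* k)).IsPrime :=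
    RingHom.ker_isPrime _
  have h2 := height_le_ringKrullDim_quotient_add_spanFinrank hker
  rw [ringKrullDim_eq_of_ringEquiv (RingHom.quotientKerEquivOfSurjective hf)] at h2
  have h3 : (RingHom.ker f).spanFinrank ≤ r := by
    rw [hz]
    refine (Submodule.spanFinrank_span_le_ncard_of_finite (Set.finite_range z)).trans ?_
    rw [← Set.image_univ]
    refine (Set.ncard_image_le Set.finite_univ).trans ?_
    simp [Set.ncard_univ]
  have h4 : ((n : ℕ∞) : WithBot ℕ∞) ≤
      ((RingHom.ker (constantCoeff : MvPolynomial (Fin n) k →+* k)).height : WithBot ℕ∞) := by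
    exact_mod_cast le_height_ker_constantCoeff n
  refine le_trans h4 (h2.trans ?_)
  gcongr

/-- Starting from dimension `n`, each quotient by a nonzerodivisor lowers the Krull dimension by at
least one. -/
theorem ringKrullDim_add_length_le {n : ℕ} {fs : List (MvPolynomial (Fin n) k)}
    (hreg : RingTheory.Sequence.IsWeaklyRegular (MvPolynomial (Fin n) k) fs) {B : Type v}
    [CommRing B] (f : MvPolynomial (Fin n) k →+* B) (hf : Function.Surjective f)
    (hker : RingHom.ker f = Ideal.ofList fs) :
    ringKrullDim B + fs.length ≤ n := by
  have key : ∀ m ≤ fs.length,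
      ringKrullDim (MvPolynomial (Fin n) k ⧸ Ideal.ofList (fs.take m)) + m ≤ n := by
    intro m
    induction m with
    | zero =>
      intro _
      rw [Nat.cast_zero, add_zero]
      refine (ringKrullDim_le_of_surjective _ Ideal.Quotient.mk_surjective).trans ?_
      rw [MvPolynomial.ringKrullDim_of_isNoetherianRing, ringKrullDim_eq_zero_of_field]
      simp
    | succ m ih =>
      intro hm
      refine le_trans ?_ (ih (by omega))
      have hle : Ideal.ofList (fs.take m) ≤ Ideal.ofList (fs.take (m + 1)) := by
        rw [ofList_take_succ fs m hm]; exact le_sup_left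
      have h1 := ringKrullDim_succ_le_of_surjective (Ideal.Quotient.factor hle)
        (Ideal.Quotient.factor_surjective hle)
        (r := Ideal.Quotient.mk (Ideal.ofList (fs.take m)) fs[m]) ?_ ?_
      · rw [Nat.cast_add, Nat.cast_one, add_comm (m : WithBot ℕ∞) 1, ← add_assoc]
        gcongr
      · rw [mem_nonZeroDivisors_iff_right]
        intro x hx
        obtain ⟨s, rfl⟩ := Ideal.Quotient.mk_surjective x
        rw [← map_mul, Ideal.Quotient.eq_zero_iff_mem] at hx
        exact Ideal.Quotient.eq_zero_iff_mem.2 (mem_ofList_take_of_mul_mem hreg m hm s hx)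
      · rw [Ideal.Quotient.factor_mk, Ideal.Quotient.eq_zero_iff_mem, ofList_take_succ fs m hm]
        exact Ideal.mem_sup_right (Ideal.mem_span_singleton_self _)
  have h1 := key fs.length le_rfl
  rwa [List.take_length, ← hker,
    ringKrullDim_eq_of_ringEquiv (RingHom.quotientKerEquivOfSurjective hf)] at h1

/-- `krullDimNat` takes the default value `0` at `⊥` and at `⊤`; nontriviality excludes the first
and the finite bound the second. -/
theorem ringKrullDim_eq_krullDimNat {B : Type v} [CommRing B] [Nontrivial B] {n : ℕ}
    (h : ringKrullDim B ≤ n) : ringKrullDim B = krullDimNat B := by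
  have h0 : 0 ≤ ringKrullDim B := ringKrullDim_nonneg_of_nontrivial
  unfold krullDimNat
  generalize ringKrullDim B = d at h h0
  induction d with
  | bot => simp at h0
  | coe d =>
    induction d with
    | top =>
      have h' : ((⊤ : ℕ∞) : WithBot ℕ∞) ≤ ((n : ℕ∞) : WithBot ℕ∞) := h
      exact absurd (WithBot.coe_le_coe.1 h') (by simp)
    | coe d => simp

theorem ker_le_ker_constantCoeff {A : Type v} [CommRing A] [Algebra k A] [Nontrivial A]
    (𝒜 : ℕ → Submodule k A) [GradedAlgebra 𝒜] {n : ℕ} (π : MvPolynomial (Fin n) k →ₐ[k] A)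
    (hX : ∀ i, π (X i) ∈ 𝒜 1) :
    RingHom.ker (π : MvPolynomial (Fin n) k →+* A) ≤
      RingHom.ker (constantCoeff : MvPolynomial (Fin n) k →+* k) := by
  -- If `π p = 0`, this puts the constant term of `p` in both `A_0` and `A_{≥ 1}`, so it vanishes.
  have h1 : ∀ p, π p - algebraMap k A (constantCoeff p) ∈ irrelevantIdeal 𝒜 := by
    intro p
    induction p using MvPolynomial.induction_on with
    | C c => simp [← MvPolynomial.algebraMap_eq]
    | add p q hp hq =>
      rw [map_add, map_add, map_add, add_sub_add_comm]
      exact add_mem hp hq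
    | mul_X p i _ =>
      rw [map_mul, map_mul, constantCoeff_X, mul_zero, map_zero, sub_zero]
      exact Ideal.mul_mem_left _ _ (mem_irrelevantIdeal_of_mem one_ne_zero (hX i))
  intro p hp
  have hp' : π p = 0 := hp
  have h2 := h1 p
  rw [hp', zero_sub, neg_mem_iff] at h2
  have h3 := eq_zero_of_mem_irrelevantIdeal (SetLike.algebraMap_mem_graded 𝒜 _) h2
  exact (map_eq_zero_iff _ (algebraMap k A).injective).1 h3

end Dimension

/-! ### Power series numerics -/

section Numerics

open PowerSeries

theorem coeff_one_mul_int (f g : ℤ⟦X⟧) :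
    coeff 1 (f * g) = coeff 0 f * coeff 1 g + coeff 1 f * coeff 0 g := by
  rw [coeff_mul, Finset.Nat.sum_antidiagonal_eq_sum_range_succ_mk]
  simp [Finset.sum_range_succ]

theorem coeff_zero_one_sub_X_pow (n : ℕ) : coeff 0 ((1 - X : ℤ⟦X⟧) ^ n) = 1 := by
  simp

theorem coeff_one_one_sub_X_pow (n : ℕ) : coeff 1 ((1 - X : ℤ⟦X⟧) ^ n) = -n := by
  induction n with
  | zero => simp [coeff_one]
  | succ n ih =>
    rw [pow_succ, coeff_one_mul_int, ih, coeff_zero_one_sub_X_pow]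
    simp [coeff_one]

theorem exists_prod_one_sub_X_pow_eq {ι : Type*} (s : Finset ι) (d : ι → ℕ)
    (hd : ∀ i ∈ s, 2 ≤ d i) :
    ∃ u : ℤ⟦X⟧, ∏ i ∈ s, (1 - X ^ d i) =
      1 - ((s.filter fun i => d i = 2).card : ℤ⟦X⟧) * X ^ 2 + X ^ 3 * u := by
  classical
  induction s using Finset.induction_on with
  | empty => exact ⟨0, by simp⟩
  | insert i s hi ih =>
    obtain ⟨u, hu⟩ := ih fun j hj => hd j (Finset.mem_insert_of_mem hj)
    rw [Finset.prod_insert hi, hu, Finset.filter_insert]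
    have h2 := hd i (Finset.mem_insert_self i s)
    by_cases h : d i = 2
    · rw [if_pos h, h, Finset.card_insert_of_notMem (by simp [hi])]
      refine ⟨u + ((s.filter fun i => d i = 2).card : ℤ⟦X⟧) * X - X ^ 2 * u, ?_⟩
      push_cast
      ring
    · rw [if_neg h]
      obtain ⟨e, he⟩ : ∃ e, d i = e + 3 := ⟨d i - 3, by omega⟩
      refine ⟨u - X ^ e * (1 - ((s.filter fun i => d i = 2).card : ℤ⟦X⟧) * X ^ 2 + X ^ 3 * u), ?_⟩
      rw [he]
      ring

/-- The numerical constraints on the degrees of a regular sequence imposed by the first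
coefficients of the Hilbert series. -/
theorem hilbertSeries_constraints {m n e : ℕ} (d : Fin m → ℕ) {H : ℤ⟦X⟧}
    (hH : H * (1 - X) ^ n = ∏ i, (1 - X ^ d i)) (h0 : coeff 0 H = 1) (h1 : coeff 1 H = e) :
    n = e + (Finset.univ.filter fun i => d i = 1).card ∧
    H * (1 - X) ^ e = ∏ i with ¬ d i = 1, (1 - X ^ d i) ∧
    ∃ u : ℤ⟦X⟧, H * (1 - X) ^ e =
      1 - ((Finset.univ.filter fun i => d i = 2).card : ℤ⟦X⟧) * X ^ 2 + X ^ 3 * u := by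
  -- A degree zero would make the product vanish, while `H * (1 - X) ^ n` has constant term `1`.
  have hpos : ∀ i, d i ≠ 0 := by
    intro i hi
    rw [Finset.prod_eq_zero (Finset.mem_univ i) (by rw [hi, pow_zero, sub_self])] at hH
    have := congrArg (coeff 0) hH
    rw [coeff_mul] at this
    simp [h0] at this
  set a := (Finset.univ.filter fun i => d i = 1).card with ha
  have hsplit : H * (1 - X) ^ n =
      (1 - X) ^ a * ∏ i with ¬ d i = 1, (1 - X ^ d i) := by
    rw [hH, ← Finset.prod_filter_mul_prod_filter_not Finset.univ (fun i => d i = 1)]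
    congr 1
    rw [ha, ← Finset.prod_const]
    refine Finset.prod_congr rfl fun i hi => ?_
    rw [(Finset.mem_filter.1 hi).2, pow_one]
  obtain ⟨u, hu⟩ := exists_prod_one_sub_X_pow_eq (Finset.univ.filter fun i => ¬ d i = 1) d
    (fun i hi => by
      have h2 := hpos i
      have h3 := (Finset.mem_filter.1 hi).2
      omega)
  have hfilter : (Finset.univ.filter fun i => ¬ d i = 1).filter (fun i => d i = 2) =
      Finset.univ.filter fun i => d i = 2 := by
    rw [Finset.filter_filter]
    refine Finset.filter_congr fun i _ => ⟨fun h => h.2, fun h => ⟨by omega, h⟩⟩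
  rw [hfilter] at hu
  set G := ∏ i with ¬ d i = 1, (1 - (X : ℤ⟦X⟧) ^ d i) with hG
  have hG0 : coeff 0 G = 1 := by rw [hu]; simp
  have hG1 : coeff 1 G = 0 := by
    rw [hu, map_add, map_sub, coeff_mul_X_pow', coeff_X_pow_mul']
    simp [coeff_one]
  -- Comparison of linear coefficients: the factors of degree at least two contribute nothing, so
  -- each linear relation removes exactly one variable.
  have hn : n = e + a := by
    have := congrArg (coeff 1) hsplit
    rw [coeff_one_mul_int, coeff_one_mul_int, coeff_one_one_sub_X_pow, coeff_one_one_sub_X_pow,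
      coeff_zero_one_sub_X_pow, coeff_zero_one_sub_X_pow, h0, h1, hG0, hG1] at this
    omega
  have hcancel : H * (1 - X) ^ e = G := by
    have hne : (1 - X : ℤ⟦X⟧) ^ a ≠ 0 := by
      intro h
      have := coeff_zero_one_sub_X_pow a
      rw [h, map_zero] at this
      exact zero_ne_one this
    refine mul_left_cancel₀ hne ?_
    rw [← hsplit, hn, pow_add]
    ring
  exact ⟨hn, hcancel, u, by rw [hcancel, hu]⟩

/-- Dividing `1 - N` by `1 - X ^ 2` gives `1 - N'` with `N' = (N - X ^ 2) / (1 - X ^ 2)`. Only the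
coefficient at `X ^ 2` loses anything, and it loses one unit, so the hypothesis is inherited with
`g` lowered by one. -/
theorem nonneg_of_mul_one_sub_sq_pow (g : ℕ) : ∀ (N A : ℤ⟦X⟧), (∀ n, 0 ≤ coeff n N) →
    (g : ℤ) ≤ coeff 2 N → A * (1 - X ^ 2) ^ g = 1 - N → ∀ n, 0 ≤ coeff n (1 - A) := by
  induction g with
  | zero =>
    intro N A hN _ h n
    rw [pow_zero, mul_one] at h
    rw [h, sub_sub_cancel]
    exact hN n
  | succ g ih =>
    intro N A hN hg h
    set N' := 1 - A * (1 - X ^ 2) ^ g with hN'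
    -- The fixed-point form of the division: it is a recursion expressing the coefficient of `N'` at
    -- `n` through the one at `n - 2`.
    have h1 : N' = N - X ^ 2 + X ^ 2 * N' := by
      have h2 : N = 1 - A * (1 - X ^ 2) ^ (g + 1) := by rw [h, sub_sub_cancel]
      rw [h2, hN']
      ring
    have h2 : ∀ n, coeff n N' = coeff n N - (if n = 2 then 1 else 0) +
        if 2 ≤ n then coeff (n - 2) N' else 0 := by
      intro n
      conv_lhs => rw [h1]
      rw [map_add, map_sub, coeff_X_pow, coeff_X_pow_mul']
    have h3 : ∀ n, 0 ≤ coeff n N' := by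
      intro n
      induction n using Nat.strong_induction_on with
      | _ n ihn =>
        rw [h2]
        have hNn := hN n
        split_ifs with h4 h5 h5
        · have := ihn (n - 2) (by omega)
          rw [h4] at this ⊢
          push_cast at hg
          omega
        · omega
        · have := ihn (n - 2) (by omega)
          omega
        · omega
    refine ih N' A h3 ?_ (by rw [hN', sub_sub_cancel])
    rw [h2, if_pos rfl, if_pos le_rfl]
    have := h3 0
    push_cast at hg
    simp only [Nat.sub_self]
    omega

end Numerics

/-! ### Koszul complete intersections -/

section KoszulCompleteIntersection

open MvPolynomial GradedFreeResolution

attribute [local instance] MvPolynomial.gradedAlgebra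

variable {k : Type u} [Field k] {Q : Type v} [CommRing Q] [Algebra k Q]
  {𝒬 : ℕ → Submodule k Q} [GradedAlgebra 𝒬]

omit [GradedAlgebra 𝒬] in
theorem coeff_zero_hilbertSeries [Nontrivial Q] (h0 : 𝒬 0 = 1) :
    PowerSeries.coeff 0 (hilbertSeries 𝒬) = 1 := by
  rw [hilbertSeries, PowerSeries.coeff_mk, h0, Submodule.one_eq_span,
    finrank_span_singleton one_ne_zero, Nat.cast_one]

/-- Linear coefficient of `P(-z) H(z) = 1`, where both constant terms are `1`. -/
theorem coeff_one_hilbertSeries [Nontrivial Q] (h0 : 𝒬 0 = 1) [∀ j, FiniteDimensional k (𝒬 j)]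
    {F : GradedFreeResolution 𝒬 (residueGrading 𝒬)} {b₀ : Fin (F.rank 0)}
    (hF : ∀ i b, F.deg i b = i) (hc : F.IsCyclicAt (irrelevantIdeal 𝒬).mkQ b₀) :
    PowerSeries.coeff 1 (hilbertSeries 𝒬) = F.rank 1 := by
  have h1 := congrArg (PowerSeries.coeff 1) (hilbertSeries_mul_eq_one h0 hF)
  rw [coeff_one_mul_int, coeff_zero_hilbertSeries h0] at h1
  simp only [PowerSeries.evalNegHom, PowerSeries.coeff_rescale, PowerSeries.coeff_mk,
    hc.rank_zero, PowerSeries.coeff_one] at h1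
  simp at h1
  linarith

theorem finiteDimensional_of_isGradedCompleteIntersection
    (hCI : IsGradedCompleteIntersection 𝒬) (j : ℕ) : FiniteDimensional k (𝒬 j) := by
  obtain ⟨n, π, _, hX, hπ, _⟩ := hCI
  exact finiteDimensional_of_surjective (gradedAlgHomOfX 𝒬 π hX) hπ j

omit [GradedAlgebra 𝒬] in
theorem isNoetherianRing_of_isGradedCompleteIntersection
    (hCI : IsGradedCompleteIntersection 𝒬) : IsNoetherianRing Q := by
  obtain ⟨n, π, _, _, hπ, _⟩ := hCI
  exact isNoetherianRing_of_surjective _ _ (π : MvPolynomial (Fin n) k →+* Q) hπ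

theorem exists_range_of_span_idealPart {n r : ℕ} {J : Ideal (MvPolynomial (Fin n) k)} {j : ℕ}
    (hJ : J = Ideal.span (idealPart (homogeneousSubmodule (Fin n) k) J j))
    (hr : Module.finrank k (idealPart (homogeneousSubmodule (Fin n) k) J j) = r) :
    ∃ z : Fin r → MvPolynomial (Fin n) k, J = Ideal.span (Set.range z) := by
  let b := Module.finBasisOfFinrankEq k _ hr
  refine ⟨fun i => b i, le_antisymm ?_ (Ideal.span_le.2 ?_)⟩
  · refine hJ.le.trans (Ideal.span_le.2 fun p hp => ?_)
    have h1 := congrArg Subtype.val (b.sum_repr ⟨p, hp⟩)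
    rw [SetLike.mem_coe, ← show _ = p from h1, AddSubmonoidClass.coe_finsetSum]
    refine Ideal.sum_mem _ fun i _ => ?_
    rw [Submodule.coe_smul, MvPolynomial.smul_eq_C_mul]
    exact Ideal.mul_mem_left _ _ (Ideal.subset_span ⟨i, rfl⟩)
  · rintro _ ⟨i, rfl⟩
    exact (b i).2.1

/-- A Koszul complete intersection is defined by a regular sequence of quadrics. -/
theorem koszul_completeIntersection [Nontrivial Q] (h0 : 𝒬 0 = 1)
    (hgen : Algebra.adjoin k (𝒬 1 : Set Q) = ⊤) (hCI : IsGradedCompleteIntersection 𝒬)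
    {F : GradedFreeResolution 𝒬 (residueGrading 𝒬)} {b₀ : Fin (F.rank 0)}
    (hF : ∀ i b, F.deg i b = i) (hc : F.IsCyclicAt (irrelevantIdeal 𝒬).mkQ b₀) :
    ∃ m : ℕ, hilbertSeries 𝒬 * (1 - PowerSeries.X) ^ F.rank 1 = (1 - PowerSeries.X ^ 2) ^ m ∧
      ringKrullDim Q + m ≤ F.rank 1 ∧ ∃ z : Fin m → MvPolynomial (Fin (F.rank 1)) k,
        RingHom.ker (aeval (R := k) (F.relation b₀)) = Ideal.span (Set.range z) := by
  have hfd := finiteDimensional_of_isGradedCompleteIntersection hCI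
  set e := F.rank 1 with he
  set ρ := aeval (R := k) (F.relation b₀) with hρ
  have hρX : ∀ b, ρ (X b) ∈ 𝒬 1 := fun b => by
    rw [hρ, aeval_X]; exact relation_mem_one hF hc b
  have hρs : Function.Surjective ρ := aeval_relation_surjective h0 hgen hF hc
  obtain ⟨n, π, fs, hX, hπ, hfs, hreg, hker⟩ := hCI
  have hfs' : ∀ i : Fin fs.length, ∃ d, fs[i].IsHomogeneous d :=
    fun i => hfs _ (List.getElem_mem i.2)
  choose d hd using hfs'
  have hH : hilbertSeries 𝒬 * (1 - PowerSeries.X) ^ n = ∏ i, (1 - PowerSeries.X ^ d i) := by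
    rw [hilbertSeries_eq_quotientHilbertSeries (gradedAlgHomOfX 𝒬 π hX) hπ
      (I := RingHom.ker π) (fun a => Iff.rfl), hker,
      quotientHilbertSeries_ofList hreg.toIsWeaklyRegular d hd, mul_comm, ← mul_assoc,
      one_sub_pow_mul_hilbertSeries, one_mul]
  obtain ⟨hn, hG, u, hu⟩ := hilbertSeries_constraints d hH (coeff_zero_hilbertSeries h0)
    (coeff_one_hilbertSeries h0 hF hc)
  set m := (Finset.univ.filter fun i => d i = 2).card with hm
  -- The given presentation may have linear relations, so it is not compared with `ρ` directly. The
  -- Hilbert series `(1 - m z^2 + O(z^3)) / (1 - z)^e` alone determines the number of quadrics in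
  -- `ker ρ`.
  have hrank : Module.finrank k
      (idealPart (homogeneousSubmodule (Fin e) k) (RingHom.ker ρ) 2) = m := by
    have h1 : Module.finrank k (𝒬 2) + Module.finrank k
        (idealPart (homogeneousSubmodule (Fin e) k) (RingHom.ker ρ) 2) =
        Module.finrank k (homogeneousSubmodule (Fin e) k 2) :=
      finrank_add_finrank_idealPart (gradedAlgHomOfX 𝒬 ρ hρX) hρs
        (I := RingHom.ker ρ) (fun a => Iff.rfl) 2
    have h2 : hilbertSeries 𝒬 = hilbertSeries (homogeneousSubmodule (Fin e) k) -
        (m : ℤ⟦X⟧) * hilbertSeries (homogeneousSubmodule (Fin e) k) * PowerSeries.X ^ 2 +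
        PowerSeries.X ^ 3 * (u * hilbertSeries (homogeneousSubmodule (Fin e) k)) := by
      have h3 := one_sub_pow_mul_hilbertSeries (k := k) e
      calc hilbertSeries 𝒬 = hilbertSeries 𝒬 * (1 - PowerSeries.X) ^ e *
            hilbertSeries (homogeneousSubmodule (Fin e) k) := by rw [mul_assoc, h3, mul_one]
        _ = _ := by rw [hu]; ring
    have h3 := congrArg (PowerSeries.coeff 2) h2
    rw [map_add, map_sub, PowerSeries.coeff_mul_X_pow', PowerSeries.coeff_X_pow_mul',
      if_pos le_rfl, if_neg (by norm_num), Nat.sub_self] at h3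
    have h4 : PowerSeries.coeff 0 ((m : ℤ⟦X⟧) * hilbertSeries (homogeneousSubmodule (Fin e) k)) =
        m := by
      have h5 := coeff_zero_hilbertSeries (𝒬 := homogeneousSubmodule (Fin e) k)
        (homogeneousSubmodule_zero _)
      rw [PowerSeries.coeff_zero_eq_constantCoeff_apply] at h5 ⊢
      rw [map_mul, h5]
      simp
    rw [h4, hilbertSeries, hilbertSeries, PowerSeries.coeff_mk, PowerSeries.coeff_mk, ← h1] at h3
    push_cast at h3
    omega
  obtain ⟨z, hz⟩ := exists_range_of_span_idealPart (ker_aeval_relation_eq_span h0 hgen hF hc) hrank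
  have hup := ringKrullDim_add_length_le hreg.toIsWeaklyRegular
    (π : MvPolynomial (Fin n) k →+* Q) hπ hker
  have hlow := le_ringKrullDim_add_of_surjective (ρ : MvPolynomial (Fin e) k →+* Q) hρs z hz
    (ker_le_ker_constantCoeff 𝒬 ρ hρX)
  have hdim := ringKrullDim_eq_krullDimNat (B := Q) (n := n)
    (le_trans (le_add_of_nonneg_right (by positivity)) hup)
  rw [hdim] at hup hlow
  have hup' : krullDimNat Q + fs.length ≤ n := by exact_mod_cast hup
  have hlow' : e ≤ krullDimNat Q + m := by exact_mod_cast hlow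
  have hsplit := Finset.card_filter_add_card_filter_not (s := Finset.univ) (fun i => d i = 1)
  rw [Finset.card_univ, Fintype.card_fin] at hsplit
  have hsub : (Finset.univ.filter fun i => d i = 2) ⊆ Finset.univ.filter fun i => ¬ d i = 1 :=
    fun i hi => by
      rw [Finset.mem_filter] at hi ⊢
      exact ⟨hi.1, by omega⟩
  have hle := Finset.card_le_card hsub
  -- From `e ≤ dim Q + m` and `dim Q + fs.length ≤ n = e + #{d i = 1}`, at most `m` relations have
  -- degree different from one, while `m` already have degree two.
  have heq := Finset.eq_of_subset_of_card_le hsub (by omega)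
  refine ⟨m, ?_, ?_, z, hz⟩
  · rw [hG, ← heq, hm, ← Finset.prod_const]
    refine Finset.prod_congr rfl fun i hi => ?_
    rw [(Finset.mem_filter.1 hi).2]
  · rw [hdim]
    have : krullDimNat Q + m ≤ e := by omega
    exact_mod_cast this

end KoszulCompleteIntersection

/-! ### Assembling the identity for the `h`-polynomial -/

section Final

open MvPolynomial

variable {k : Type u} [Field k] {Q : Type v} [CommRing Q] [Algebra k Q]
  {R : Type w} [CommRing R] [Algebra k R] {n m μ : ℕ}

/-- Generators of the kernel of a composite of surjections. -/
theorem ker_comp_eq_span_append (ρ : MvPolynomial (Fin n) k →ₐ[k] Q)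
    (hρ : Function.Surjective ρ) (φ : Q →ₐ[k] R) {z : Fin m → MvPolynomial (Fin n) k}
    (hz : RingHom.ker ρ = Ideal.span (Set.range z)) {y : Fin μ → Q}
    (hy : ∀ a, φ a = 0 ↔ ∃ v : Fin μ → Q, ∑ b, v b * y b = a) :
    ∃ t : Fin (m + μ) → MvPolynomial (Fin n) k,
      RingHom.ker (φ.comp ρ) = Ideal.span (Set.range t) := by
  choose t ht using fun b => hρ (y b)
  refine ⟨Fin.append z t, le_antisymm (fun p hp => ?_) (Ideal.span_le.2 ?_)⟩
  · obtain ⟨v, hv⟩ := (hy (ρ p)).1 hp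
    choose V hV using fun b => hρ (v b)
    have h1 : p - ∑ b, V b * t b ∈ RingHom.ker ρ := by
      rw [RingHom.mem_ker, map_sub, map_sum, ← hv, sub_eq_zero]
      exact Finset.sum_congr rfl fun b _ => by rw [map_mul, hV, ht]
    rw [← sub_add_cancel p (∑ b, V b * t b)]
    refine add_mem ?_ (Ideal.sum_mem _ fun b _ => Ideal.mul_mem_left _ _ ?_)
    · rw [hz] at h1
      refine Ideal.span_mono ?_ h1
      rintro _ ⟨i, rfl⟩
      exact ⟨i.castAdd μ, Fin.append_left z t i⟩
    · exact Ideal.subset_span ⟨b.natAdd m, Fin.append_right z t b⟩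
  · rintro _ ⟨i, rfl⟩
    refine Fin.addCases (fun i => ?_) (fun b => ?_) i
    · rw [Fin.append_left]
      have h1 : z i ∈ RingHom.ker ρ := by rw [hz]; exact Ideal.subset_span ⟨i, rfl⟩
      change φ (ρ (z i)) = 0
      rw [(RingHom.mem_ker).1 h1, map_zero]
    · rw [Fin.append_right]
      change φ (ρ (t b)) = 0
      rw [ht, hy]
      exact ⟨Pi.single b 1, by simp [Pi.single_apply]⟩

theorem evalNegHom_one_sub_X_pow_two : PowerSeries.evalNegHom (1 - PowerSeries.X ^ 2 : ℤ⟦X⟧) =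
    1 - PowerSeries.X ^ 2 := by
  rw [map_sub, map_one, map_pow, PowerSeries.evalNegHom_X, neg_sq]

theorem one_sub_X_sq_pow_ne_zero (m : ℕ) : (1 - PowerSeries.X ^ 2 : ℤ⟦X⟧) ^ m ≠ 0 := by
  intro h
  have := congrArg (PowerSeries.constantCoeff (R := ℤ)) h
  simp at this

/-- The relation between the series `1 - h(-z) / (1 - z)^c` and `N`. -/
theorem hilbert_quotient_identity {HQ HR N : ℤ⟦X⟧} {d g m e : ℕ} (he : e = d + (g + m))
    (hQ : HQ * (1 - PowerSeries.X) ^ e = (1 - PowerSeries.X ^ 2) ^ m)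
    (hN : (1 - N) * PowerSeries.evalNegHom HQ = PowerSeries.evalNegHom HR) :
    PowerSeries.evalNegHom ((1 - PowerSeries.X) ^ d * HR) *
      (PowerSeries.invOneSubPow ℤ (g + m) : ℤ⟦X⟧) * (1 - PowerSeries.X ^ 2) ^ g = 1 - N := by
  have hinv : (PowerSeries.invOneSubPow ℤ (g + m) : ℤ⟦X⟧) * (1 - PowerSeries.X) ^ (g + m) = 1 := by
    rw [← PowerSeries.invOneSubPow_inv_eq_one_sub_pow]
    exact Units.mul_inv _
  have hQ' := congrArg PowerSeries.evalNegHom hQ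
  rw [map_mul, map_pow, map_pow, evalNegHom_one_sub_X_pow_two, map_sub, map_one,
    PowerSeries.evalNegHom_X, sub_neg_eq_add] at hQ'
  rw [map_mul, map_pow, map_sub, map_one, PowerSeries.evalNegHom_X, sub_neg_eq_add, ← hN]
  refine mul_right_cancel₀ (one_sub_X_sq_pow_ne_zero m) ?_
  -- The factor `(1 - X) ^ (g + m)` cancels the denominator and `(1 + X) ^ (g + m)` completes `(1 +
  -- X) ^ d` to `(1 + X) ^ e`, which turns `H_Q(-z)` into `(1 - X ^ 2) ^ m`.
  have hfac : (1 - PowerSeries.X ^ 2 : ℤ⟦X⟧) ^ g * (1 - PowerSeries.X ^ 2) ^ m =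
      (1 + PowerSeries.X) ^ (g + m) * (1 - PowerSeries.X) ^ (g + m) := by
    rw [← pow_add, ← mul_pow]
    congr 1
    ring
  calc _ = (1 + PowerSeries.X) ^ d * ((1 - N) * PowerSeries.evalNegHom HQ) *
        (PowerSeries.invOneSubPow ℤ (g + m) : ℤ⟦X⟧) *
        ((1 - PowerSeries.X ^ 2) ^ g * (1 - PowerSeries.X ^ 2) ^ m) := by ring
    _ = (1 - N) * (PowerSeries.evalNegHom HQ * (1 + PowerSeries.X) ^ (d + (g + m))) *
        ((PowerSeries.invOneSubPow ℤ (g + m) : ℤ⟦X⟧) * (1 - PowerSeries.X) ^ (g + m)) := by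
      rw [hfac]; ring
    _ = _ := by rw [hinv, ← he, hQ', mul_one]

end Final

end

/-- If `R` is a standard graded Koszul `k`-algebra with the Backelin-Roos property, then
`1 - h_R(-z) / (1 - z)^c` has non-negative coefficients, where `c = codim R`. -/
theorem mainTheorem8 {k : Type u} [Field k] {R : Type v} [CommRing R] [Algebra k R]
    (ℛ : ℕ → Submodule k R) [GradedAlgebra ℛ] (hR : IsStandardGraded ℛ)
    (hKoszul : IsKoszul ℛ) (hBR : HasBackelinRoos ℛ) (n : ℕ) :
    0 ≤ PowerSeries.coeff n
      (1 - PowerSeries.evalNegHom (hPolynomial ℛ) *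
        (PowerSeries.invOneSubPow ℤ (gradedCodim ℛ) : ℤ⟦X⟧)) := by
  obtain ⟨Q, _, _, 𝒬, _, φ, hQ, hCI, hG⟩ := hBR
  have := hR.nontrivial
  have := hQ.nontrivial
  have hNoeth := isNoetherianRing_of_isGradedCompleteIntersection hCI
  have hfdQ := finiteDimensional_of_isGradedCompleteIntersection hCI
  have hfdR := finiteDimensional_of_surjective φ hG.1
  obtain ⟨⟨F, b₀, hF, hc⟩, N, hN, hN0, hN1, hNeq, μ, y, hμ, hy⟩ :=
    exists_of_isGolod hQ.degree_zero hR.degree_zero hKoszul φ hG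
  obtain ⟨m, hH, hdimQ, z, hz⟩ :=
    koszul_completeIntersection hQ.degree_zero hQ.adjoin_one hCI hF hc
  have hρs := aeval_relation_surjective hQ.degree_zero hQ.adjoin_one hF hc
  obtain ⟨t, ht⟩ := ker_comp_eq_span_append _ hρs (φ : Q →ₐ[k] R) hz hy
  have hX : ∀ b, ((φ : Q →ₐ[k] R).comp (MvPolynomial.aeval (F.relation b₀)))
      (MvPolynomial.X b) ∈ ℛ 1 := fun b => by
    rw [AlgHom.comp_apply, MvPolynomial.aeval_X]
    exact φ.map_mem (relation_mem_one hF hc b)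
  have hlow := le_ringKrullDim_add_of_surjective
    ((φ : Q →ₐ[k] R).comp (MvPolynomial.aeval (F.relation b₀)) :
      MvPolynomial (Fin (F.rank 1)) k →+* R) (hG.1.comp hρs) t ht
    (ker_le_ker_constantCoeff ℛ _ hX)
  have hup : ringKrullDim R + m ≤ F.rank 1 :=
    le_trans (by
      gcongr
      exact ringKrullDim_le_of_surjective (φ : Q →ₐ[k] R).toRingHom hG.1) hdimQ
  have hdim := ringKrullDim_eq_krullDimNat (B := R) (n := F.rank 1)
    (le_trans (le_add_of_nonneg_right (by positivity)) hup)
  rw [hdim] at hup hlow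
  have hup' : krullDimNat R + m ≤ F.rank 1 := by exact_mod_cast hup
  have hlow' : F.rank 1 ≤ krullDimNat R + (m + μ) := by exact_mod_cast hlow
  -- `N` starts in degree two, so the linear coefficients of `H_Q(-z)` and `H_R(-z)` agree.
  have hembdim : Module.finrank k (ℛ 1) = F.rank 1 := by
    have h1 := congrArg (PowerSeries.coeff 1) hNeq
    rw [coeff_one_mul_int, map_sub, map_sub, hN0, hN1] at h1
    simp only [PowerSeries.evalNegHom, PowerSeries.coeff_rescale,
      coeff_one_hilbertSeries hQ.degree_zero hF hc, PowerSeries.coeff_one] at h1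
    simp at h1
    have h2 := h1.symm
    rw [hilbertSeries, PowerSeries.coeff_mk] at h2
    exact_mod_cast h2
  -- `g` is the codimension of `R` beyond the `m` quadrics of `Q`; `hup'` makes the subtraction
  -- exact, and `hlow'` gives `g ≤ μ`.
  obtain ⟨g, hg⟩ : ∃ g, F.rank 1 = krullDimNat R + (g + m) :=
    ⟨F.rank 1 - krullDimNat R - m, by omega⟩
  have hcodim : gradedCodim ℛ = g + m := by rw [gradedCodim, hembdim]; omega
  rw [hcodim]
  refine nonneg_of_mul_one_sub_sq_pow g N _ hN ?_ (hilbert_quotient_identity hg hH hNeq) n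
  rw [hμ]
  exact_mod_cast (by omega : g ≤ μ)
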